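/- **Setting.** Processes with totally ordered identifiers communicate by asynchronous point-to-point messages and may crash. A finite set $\mathcal S$ of processes are the replicas. Tags are pairs $\langle z, p\rangle$ of a non-negative integer and a process identifier, ordered lexicographically; they serve as versions. Let $\tau_0$ be any initial tag and $v_0$ any initial value; initially every replica stores $\langle\tau_0,v_0\rangle$. Each process has at most one operation under way at a time, either $\mathrm{cvr\text{-}read}()$ or $\mathrm{cvr\text{-}write}(val,ver)$, where $ver$ is an arbitrary tag. **Algorithm vMWABD.** An operation has two phases. *Query phase:* the process sends a query to all replicas, waits until it has received the tag-value pairs of a majority of them, and selects among the pairs received one, $\langle\tau,v\rangle$, with the largest tag $\tau=\langle z,\cdot\rangle$. A $\mathrm{cvr\text{-}write}(val,ver)$ by $p$ with $ver=\tau$ sets $\langle\tau_{new},val_{new}\rangle=\langle\langle z+1,p\rangle,val\rangle$; a $\mathrm{cvr\text{-}write}(val,ver)$ with $ver\ne\tau$ and a $\mathrm{cvr\text{-}read}$ set $\langle\tau_{new},val_{new}\rangle=\langle\tau,v\rangle$. *Propagation phase:* the process sends $\langle\tau_{new},val_{new}\rangle$ to all replicas and waits for acks from a majority of them. A read then returns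 $(val_{new},\tau_{new})$; a write returns $(val_{new},\tau_{new},chg)$ if $ver=\tau$ and $(val_{new},\tau_{new},unchg)$ otherwise. *Replicas* answer a query with their stored pair; on receipt of a propagated pair they store it if its tag is larger than the stored tag, and reply with an ack. Replies are matched to the phase and operation they answer. **Histories.** The history of a (finite or infinite) execution is its sequence of invocations and responses; $\pi_1\to\pi_2$ means that the response of $\pi_1$ occurs before the invocation of $\pi_2$. A completion of a history consists of a set $\Pi$ of operations that contains all complete operations and possibly some incomplete ones, with a response for each operation in $\Pi$, which is the actual one if the operation is complete; an incomplete operation precedes ($\to$) no operation. The responses have the right form: a read returns a value and a version, a write returns a value, a version and a flag; a write with flag $chg$ returns the value it wrote, and a write with flag $unchg$ returns a version other than the requested one. $\mathcal W$ denotes the set of successful writes in $\Pi$, i.e. those with flag $chg$; $\omega[ver\to ver']\in\mathcal W$ means that the write $\omega$ requested version $ver$ and returned version $ver'$. Reads are the reads and the unsuccessful ($unchg$) writes in $\Pi$. $\mathit{Versions}$ is the set of versions returned by writes in $\mathcal W$, together with $\tau_0$. A chain with $m$ revisions from $a$ to $b$ is a sequence of versions $a=s_0,\dots,s_m=b$ such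 that for each $i<m$ some write in $\mathcal W$ is of the form $\omega[s_i\to s_{i+1}]$. **Theorem.** Algorithm vMWABD implements a weakly coverable atomic register: (i) *Safety.* For every execution there are a completion of its history and a strict partial order $\prec$ on $\Pi$ such that - **A1**: if $\pi_1\to\pi_2$ then not $\pi_2\prec\pi_1$; - **A2**: if $\pi\in\mathcal W$ and $\pi'\in\Pi$, $\pi'\neq\pi$, then $\pi\prec\pi'$ or $\pi'\prec\pi$; - **A3**: each read returns the value and version written by the last write of $\mathcal W$ that precedes it in $\prec$, or $v_0,\tau_0$ if there is none; - **Validity**: $ver<ver'$ for every $\omega[ver\to ver']\in\mathcal W$; distinct writes in $\mathcal W$ return distinct versions; for each version in $\mathit{Versions}$ there is a chain from $\tau_0$ to it; - **Consolidation**: if $\omega_1[*\to ver_i],\ \omega_2[ver_j\to *]\in\mathcal W$ and $\omega_1\to\omega_2$, then $ver_i\le ver_j$ and $\omega_1\prec\omega_2$; - **Continuity**: if $\omega_2[ver\to *]\in\mathcal W$, then $ver=\tau_0$ or there is $\omega_1[*\to ver]\in\mathcal W$ with $\omega_1\prec\omega_2$; - **Evolution**: if $ver,ver',ver''\in\mathit{Versions}$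 and there are chains from $ver$ to $ver'$ with $k$ revisions and from $ver$ to $ver''$ with $\ell$ revisions, where $k<\ell$, then $ver'<ver''$. In particular, if all operations of the execution are complete, this holds for the set $\Pi$ of all operations with their actual responses. (ii) *Termination.* In every fair execution (every message between processes that never crash is eventually delivered, and such processes eventually take their enabled local steps) in which a majority of the replicas never crash, every operation invoked by a process that never crashes completes. -/

import Mathlib

/-! ### Versioned registers: histories, atomicity, weak coverability -/

namespace VersionedRegister

/-- Requests on a versioned register: `cvr-read()` and `cvr-write(val, ver)`. -/
inductive Request (V Ver : Type*) where
  | read : Request V Ver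
  | write (val : V) (ver : Ver) : Request V Ver

/-- The flag returned by a write. -/
inductive Flag where
  | chg : Flag
  | unchg : Flag

/-- Responses: a read returns value and version; a write returns value, version and flag. -/
inductive Response (V Ver : Type*) where
  | read (val : V) (ver : Ver) : Response V Ver
  | write (val : V) (ver : Ver) (flag : Flag) : Response V Ver

/-- Invocation and response events at a process. -/
inductive Event (P V Ver : Type*) where
  | inv (p : P) (i : Request V Ver) : Event P V Ver
  | res (p : P) (r : Response V Ver) : Event P V Ver

/-- The process at which an event takes place. -/
def Event.proc {P V Ver : Type*} : Event P V Ver → P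
  | .inv p _ => p
  | .res p _ => p

/-- A history, indexed by the steps of an execution; `none` at the steps that are neither an
invocation nor a response. -/
abbrev History (P V Ver : Type*) := ℕ → Option (Event P V Ver)

variable {P V Ver : Type*}

/-- Operations are named by the step of their invocation: `Invokes H t p i` says that step `t`
is the invocation step of an operation with request `i` by process `p`. -/
def Invokes (H : History P V Ver) (t : ℕ) (p : P) (i : Request V Ver) : Prop :=
  H t = some (Event.inv p i)

/-- Step `t'` is the matching response step, with response `r`, of the operation invoked at
step `t`: the next event of the same process. -/
def RespondsAt (H : History P V Ver) (t t' : ℕ) (r : Response V Ver) : Prop :=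
  ∃ p i, Invokes H t p i ∧ t < t' ∧ H t' = some (Event.res p r) ∧
    ∀ u, t < u → u < t' → ∀ e, H u = some e → e.proc ≠ p

/-- The operation invoked at step `t` is complete. -/
def IsComplete (H : History P V Ver) (t : ℕ) : Prop :=
  ∃ t' r, RespondsAt H t t' r

/-- Real-time precedence `π₁ → π₂`: the response step of `π₁` appears before the invocation
step of `π₂`. -/
def Precedes (H : History P V Ver) (t₁ t₂ : ℕ) : Prop :=
  ∃ t' r, RespondsAt H t₁ t' r ∧ t' < t₂

/-- A completion of a history: a set `ops` of operations that contains all complete operations,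
and possibly some incomplete ones, with a response for each of them, which is the actual response
for complete operations. (Incomplete operations outside `ops` are dropped; those in `ops` get
their response after the end of the history and so precede no operation.) If all operations are
complete, `ops` is the set of all operations and `resp` gives their actual responses. -/
structure IsCompletion (H : History P V Ver) (ops : Set ℕ) (resp : ℕ → Response V Ver) :
    Prop where
  invoked : ∀ t ∈ ops, ∃ p i, Invokes H t p i
  complete : ∀ t t' r, RespondsAt H t t' r → t ∈ ops ∧ resp t = r

/-- The responses that the transitions of a versioned register admit for a request: a write that
changes the register returns the value it wrote, and a write that does not change it returns a
version different from the one it intended to overwrite. -/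
def Request.Admits : Request V Ver → Response V Ver → Prop
  | .read, .read _ _ => True
  | .write v _, .write v' _ .chg => v' = v
  | .write _ ver, .write _ ver' .unchg => ver' ≠ ver
  | _, _ => False

/-- Every operation in `ops` has a response of the right form. -/
def WellTyped (H : History P V Ver) (ops : Set ℕ) (resp : ℕ → Response V Ver) : Prop :=
  ∀ t ∈ ops, ∀ p i, Invokes H t p i → i.Admits (resp t)

/-- `t` is a successful write of value `v` that revises version `ver` to version `ver'`. -/
def SuccWriteVal (H : History P V Ver) (ops : Set ℕ) (resp : ℕ → Response V Ver)
    (t : ℕ) (v : V) (ver ver' : Ver) : Prop :=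
  t ∈ ops ∧ (∃ p, Invokes H t p (Request.write v ver)) ∧ resp t = Response.write v ver' Flag.chg

/-- `t` is a successful write that revises version `ver` to version `ver'`. -/
def SuccWrite (H : History P V Ver) (ops : Set ℕ) (resp : ℕ → Response V Ver)
    (t : ℕ) (ver ver' : Ver) : Prop :=
  ∃ v, SuccWriteVal H ops resp t v ver ver'

/-- `t` is a successful write. -/
def IsWrite (H : History P V Ver) (ops : Set ℕ) (resp : ℕ → Response V Ver) (t : ℕ) : Prop :=
  ∃ ver ver', SuccWrite H ops resp t ver ver'

/-- `t` is a read, or an unsuccessful write, that returns value `v` and version `ver`. -/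
def ReadReturns (ops : Set ℕ) (resp : ℕ → Response V Ver) (t : ℕ) (v : V) (ver : Ver) : Prop :=
  t ∈ ops ∧ (resp t = Response.read v ver ∨ resp t = Response.write v ver Flag.unchg)

/-- Atomicity with respect to the partial order `lt` on the operations `ops`. In `A2` and `A3` a
write is a successful write, and a read is a read or an unsuccessful write. -/
structure IsAtomic (ver₀ : Ver) (v₀ : V) (H : History P V Ver) (ops : Set ℕ)
    (resp : ℕ → Response V Ver) (lt : ℕ → ℕ → Prop) : Prop where
  irrefl : ∀ a ∈ ops, ¬ lt a a
  trans : ∀ a ∈ ops, ∀ b ∈ ops, ∀ c ∈ ops, lt a b → lt b c → lt a c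
  A1 : ∀ a ∈ ops, ∀ b ∈ ops, Precedes H a b → ¬ lt b a
  A2 : ∀ a ∈ ops, ∀ b ∈ ops, IsWrite H ops resp a → a ≠ b → lt a b ∨ lt b a
  A3 : ∀ t v ver, ReadReturns ops resp t v ver →
    (∃ w ver', SuccWriteVal H ops resp w v ver' ver ∧ lt w t ∧
      ∀ w', IsWrite H ops resp w' → lt w' t → w' = w ∨ lt w' w) ∨
    ((∀ w, IsWrite H ops resp w → ¬ lt w t) ∧ v = v₀ ∧ ver = ver₀)

/-- The set of versions produced by successful writes, together with the initial version. -/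
def Versions (ver₀ : Ver) (H : History P V Ver) (ops : Set ℕ) (resp : ℕ → Response V Ver) :
    Set Ver :=
  {ver | ver = ver₀ ∨ ∃ t ver', SuccWrite H ops resp t ver' ver}

/-- There is a sequence of versions from `a` to `b` with `m` revisions by successful writes. -/
def RevisionChain (H : History P V Ver) (ops : Set ℕ) (resp : ℕ → Response V Ver)
    (m : ℕ) (a b : Ver) : Prop :=
  ∃ s : ℕ → Ver, s 0 = a ∧ s m = b ∧ ∀ i < m, ∃ t, SuccWrite H ops resp t (s i) (s (i + 1))

/-- Validity. -/
structure IsValid [LinearOrder Ver] (ver₀ : Ver) (H : History P V Ver) (ops : Set ℕ)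
    (resp : ℕ → Response V Ver) : Prop where
  increasing : ∀ t ver ver', SuccWrite H ops resp t ver ver' → ver < ver'
  unique : ∀ t₁ t₂ a b ver' ver'', t₁ ≠ t₂ → SuccWrite H ops resp t₁ a ver' →
    SuccWrite H ops resp t₂ b ver'' → ver' ≠ ver''
  derived : ∀ ver ∈ Versions ver₀ H ops resp, ∃ k, RevisionChain H ops resp k ver₀ ver

/-- Weak coverability with respect to the order `lt` on the successful writes. -/
structure IsWeaklyCoverable [LinearOrder Ver] (ver₀ : Ver) (H : History P V Ver) (ops : Set ℕ)
    (resp : ℕ → Response V Ver) (lt : ℕ → ℕ → Prop) : Prop where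
  consolidation : ∀ t₁ t₂ a verᵢ verⱼ b, SuccWrite H ops resp t₁ a verᵢ →
    SuccWrite H ops resp t₂ verⱼ b → Precedes H t₁ t₂ → verᵢ ≤ verⱼ ∧ lt t₁ t₂
  continuity : ∀ t₂ ver verᵢ, SuccWrite H ops resp t₂ ver verᵢ →
    (∃ t₁ a, SuccWrite H ops resp t₁ a ver ∧ lt t₁ t₂) ∨ ver = ver₀
  evolution : ∀ ver ∈ Versions ver₀ H ops resp, ∀ ver' ∈ Versions ver₀ H ops resp,
    ∀ ver'' ∈ Versions ver₀ H ops resp, ∀ k l, RevisionChain H ops resp k ver ver' →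
    RevisionChain H ops resp l ver ver'' → k < l → ver' < ver''

/-- A history is that of a weakly coverable atomic register with initial version `ver₀` and
initial value `v₀` if it has a completion that is valid, atomic and weakly coverable with respect
to one and the same order. -/
def IsWeaklyCoverableAtomic [LinearOrder Ver] (ver₀ : Ver) (v₀ : V) (H : History P V Ver) :
    Prop :=
  ∃ (ops : Set ℕ) (resp : ℕ → Response V Ver) (lt : ℕ → ℕ → Prop),
    IsCompletion H ops resp ∧ WellTyped H ops resp ∧
    IsAtomic ver₀ v₀ H ops resp lt ∧
    IsValid ver₀ H ops resp ∧
    IsWeaklyCoverable ver₀ H ops resp lt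

end VersionedRegister

/-! ### The algorithm as a transition system -/

namespace VMWABD

open VersionedRegister

/-- Tags: an integer and a writer identifier, ordered lexicographically. -/
abbrev Tag (P : Type*) := ℕ ×ₗ P

/-- Contents of messages. -/
inductive Body (P V : Type*) where
  | query : Body P V
  | queryReply (pair : Tag P × V) : Body P V
  | propagate (pair : Tag P × V) : Body P V
  | ack : Body P V

/-- A message; `seq` is the number of the sender's (for requests) or the addressee's (for
replies) operation to which it belongs. -/
structure Msg (P V : Type*) where
  src : P
  dst : P
  seq : ℕ
  body : Body P V

/-- What a process is doing as a client: nothing; the query phase of an operation, with the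
replies received so far; or its propagation phase, with the largest tag `τ` found in the query
phase, the pair being propagated and the set of replicas from which an ack was received. -/
inductive Phase (P V : Type*) where
  | idle : Phase P V
  | query (req : Request V (Tag P)) (replies : P → Option (Tag P × V)) : Phase P V
  | propagation (req : Request V (Tag P)) (τ : Tag P) (pair : Tag P × V) (acks : Finset P) :
      Phase P V

/-- State of a process; `pair` is the tag-value pair that it stores as a replica, and `seq` the
number of operations it has invoked. -/
structure ProcState (P V : Type*) where
  crashed : Prop
  seq : ℕ
  phase : Phase P V
  pair : Tag P × V

/-- Global state: the processes and the messages in transit. -/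
structure State (P V : Type*) where
  proc : P → ProcState P V
  net : Multiset (Msg P V)

/-- Actions of the system. -/
inductive Action (P V : Type*) where
  | invoke (p : P) (req : Request V (Tag P)) : Action P V
  | endQuery (p : P) : Action P V
  | respond (p : P) (r : Response V (Tag P)) : Action P V
  | deliver (m : Msg P V) : Action P V
  | crash (p : P) : Action P V

variable {P V : Type*}

/-- Initially all replicas hold the initial tag and value and nothing is under way. -/
def initial (τ₀ : Tag P) (v₀ : V) : State P V where
  proc := fun _ => { crashed := False, seq := 0, phase := .idle, pair := (τ₀, v₀) }
  net := 0

/-- The messages with the given body from `p` to all the replicas. -/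
def broadcast (S : Finset P) (p : P) (seq : ℕ) (body : Body P V) : Multiset (Msg P V) :=
  S.val.map fun r => { src := p, dst := r, seq := seq, body := body }

/-- `Q` contains a majority of the replicas `S`. -/
def IsMajority (S : Finset P) (Q : Set P) : Prop :=
  S.card < 2 * ((S : Set P) ∩ Q).ncard

/-- `(τ, v)` is a pair with the largest tag among the replies. -/
def IsMaxReply [LinearOrder P] (S : Finset P) (replies : P → Option (Tag P × V))
    (τ : Tag P) (v : V) : Prop :=
  (∃ r ∈ S, replies r = some (τ, v)) ∧
    ∀ r ∈ S, ∀ τ' v', replies r = some (τ', v') → τ' ≤ τ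

/-- The pair that `p` propagates after finding `(τ, v)` in its query phase. -/
def newPair [LinearOrder P] (p : P) (req : Request V (Tag P)) (τ : Tag P) (v : V) : Tag P × V :=
  match req with
  | .read => (τ, v)
  | .write val ver => if ver = τ then (toLex ((ofLex τ).1 + 1, p), val) else (τ, v)

/-- The response to a request after `τ` was found in the query phase and `pair` propagated. -/
def response [LinearOrder P] (req : Request V (Tag P)) (τ : Tag P) (pair : Tag P × V) :
    Response V (Tag P) :=
  match req with
  | .read => .read pair.2 pair.1
  | .write _ ver => .write pair.2 pair.1 (if ver = τ then .chg else .unchg)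

/-- Handling of a received message: the new state of the addressee and the messages it sends.
Replies that do not belong to the current phase of the current operation are ignored. -/
def receive [LinearOrder P] (st : ProcState P V) (m : Msg P V) :
    ProcState P V × Multiset (Msg P V) :=
  match m.body with
  | .query => (st, {{ src := m.dst, dst := m.src, seq := m.seq, body := .queryReply st.pair }})
  | .propagate pair =>
      ({ st with pair := if st.pair.1 < pair.1 then pair else st.pair },
        {{ src := m.dst, dst := m.src, seq := m.seq, body := .ack }})
  | .queryReply pair =>
      match st.phase with
      | .query req replies =>
          if m.seq = st.seq then
            ({ st with phase := .query req (Function.update replies m.src (some pair)) }, 0)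
          else (st, 0)
      | _ => (st, 0)
  | .ack =>
      match st.phase with
      | .propagation req τ pair acks =>
          if m.seq = st.seq then
            ({ st with phase := .propagation req τ pair (insert m.src acks) }, 0)
          else (st, 0)
      | _ => (st, 0)

/-- The steps of the algorithm with set of replicas `S`. A process takes steps only as long as it
has not crashed, and invokes an operation only when it has no operation under way. The requested
version of a write is arbitrary. -/
inductive Step [LinearOrder P] (S : Finset P) : State P V → Action P V → State P V → Prop where
  | invoke (s : State P V) (p : P) (req : Request V (Tag P))
      (alive : ¬ (s.proc p).crashed) (idle : (s.proc p).phase = .idle) :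
      Step S s (.invoke p req)
        { proc := Function.update s.proc p
            { s.proc p with seq := (s.proc p).seq + 1, phase := .query req fun _ => none }
          net := s.net + broadcast S p ((s.proc p).seq + 1) .query }
  | endQuery (s : State P V) (p : P) (req : Request V (Tag P))
      (replies : P → Option (Tag P × V)) (τ : Tag P) (v : V)
      (alive : ¬ (s.proc p).crashed) (phase : (s.proc p).phase = .query req replies)
      (majority : IsMajority S {r | replies r ≠ none}) (max : IsMaxReply S replies τ v) :
      Step S s (.endQuery p)
        { proc := Function.update s.proc p
            { s.proc p with phase := .propagation req τ (newPair p req τ v) ∅ }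
          net := s.net + broadcast S p (s.proc p).seq (.propagate (newPair p req τ v)) }
  | respond (s : State P V) (p : P) (req : Request V (Tag P)) (τ : Tag P) (pair : Tag P × V)
      (acks : Finset P)
      (alive : ¬ (s.proc p).crashed) (phase : (s.proc p).phase = .propagation req τ pair acks)
      (majority : IsMajority S (acks : Set P)) :
      Step S s (.respond p (response req τ pair))
        { s with proc := Function.update s.proc p { s.proc p with phase := .idle } }
  | deliver (s : State P V) (m : Msg P V) (rest : Multiset (Msg P V))
      (transit : s.net = m ::ₘ rest) (alive : ¬ (s.proc m.dst).crashed) :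
      Step S s (.deliver m)
        { proc := Function.update s.proc m.dst (receive (s.proc m.dst) m).1
          net := rest + (receive (s.proc m.dst) m).2 }
  | crash (s : State P V) (p : P) :
      Step S s (.crash p)
        { s with proc := Function.update s.proc p { s.proc p with crashed := True } }

/-- Executions from the initial state. `act t = none` means that nothing happens at time `t`, so
finite executions are those in which nothing happens from some time on. -/
structure Execution [LinearOrder P] (S : Finset P) (τ₀ : Tag P) (v₀ : V) where
  state : ℕ → State P V
  act : ℕ → Option (Action P V)
  init : state 0 = initial τ₀ v₀
  idle : ∀ t, act t = none → state (t + 1) = state t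
  step : ∀ t a, act t = some a → Step S (state t) a (state (t + 1))

/-- The event of the register's interface in an action. -/
def Action.event : Action P V → Option (Event P V (Tag P))
  | .invoke p req => some (.inv p req)
  | .respond p r => some (.res p r)
  | _ => none

variable [LinearOrder P] {S : Finset P} {τ₀ : Tag P} {v₀ : V}

/-- The history of an execution. -/
def Execution.history (ξ : Execution S τ₀ v₀) : History P V (Tag P) :=
  fun t => (ξ.act t).bind Action.event

/-- Process `p` never crashes. -/
def Execution.Correct (ξ : Execution S τ₀ v₀) (p : P) : Prop :=
  ∀ t, ξ.act t ≠ some (.crash p)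

/-- The action `a` is a local step by which `p` ends a phase of its operation. -/
def Action.IsLocal (p : P) (a : Action P V) : Prop :=
  a = .endQuery p ∨ ∃ r, a = .respond p r

/-- Fairness. Channels between correct processes are reliable: no message stays in transit
forever. A correct process takes a local step unless none is enabled. (Nothing is required of the
messages of a crashed process, so a crash in the middle of a broadcast is accounted for.) -/
structure Execution.Fair (ξ : Execution S τ₀ v₀) : Prop where
  deliver : ∀ m : Msg P V, ξ.Correct m.src → ξ.Correct m.dst →
    ∀ t, m ∈ (ξ.state t).net → ∃ t' ≥ t, ξ.act t' = some (.deliver m)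
  localStep : ∀ p, ξ.Correct p → ∀ t, ∃ t' ≥ t,
    (∃ a, a.IsLocal p ∧ ξ.act t' = some a) ∨ ¬ ∃ a s', a.IsLocal p ∧ Step S (ξ.state t') a s'

end VMWABD

/-!
Any two majorities of replicas intersect, and the tags that a replica stores never decrease. Hence
the largest tag that an operation finds in its query phase is at least the tag propagated by every
operation that precedes it. Every tag found is `τ₀` or was created by a successful write, which
raised the integer of the tag it found by one; so that integer counts the revisions since `τ₀`.
A tag has one creator, because it names the writer and because the successive operations of a
process find tags at least as large as those it propagated before. The operations are ordered by
the tags they return, the creator of a tag coming before all other operations that return it.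

An operation of a correct process that never completed would stay in one of its phases forever;
but the messages of that phase are eventually answered by all correct replicas, which form a
majority, so that the local step that ends the phase is enabled from some time on.
-/

namespace VersionedRegister

variable {P V Ver : Type*}

/-- The version that a response carries. -/
def Response.version : Response V Ver → Ver
  | .read _ ver => ver
  | .write _ ver _ => ver

/-- The order of operations by the versions they return, in which a successful write comes before
the reads of the version it creates. -/
def VersionLT [LT Ver] (H : History P V Ver) (ops : Set ℕ) (resp : ℕ → Response V Ver)
    (a b : ℕ) : Prop :=
  (resp a).version < (resp b).version ∨
    (resp a).version = (resp b).version ∧ IsWrite H ops resp a ∧ ¬ IsWrite H ops resp b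

variable {H : History P V Ver} {ops : Set ℕ} {resp : ℕ → Response V Ver} {ver₀ ver ver' : Ver}
  {v₀ : V} {t t₁ t₂ : ℕ}

theorem Invokes.unique {p q : P} {i j : Request V Ver} (hp : Invokes H t p i)
    (hq : Invokes H t q j) : p = q ∧ i = j := by
  simpa using hp.symm.trans hq

theorem SuccWrite.mem_ops (h : SuccWrite H ops resp t ver ver') : t ∈ ops := by
  obtain ⟨_, ht, _, _⟩ := h
  exact ht

theorem SuccWrite.isWrite (h : SuccWrite H ops resp t ver ver') : IsWrite H ops resp t :=
  ⟨ver, ver', h⟩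

theorem SuccWrite.version_eq (h : SuccWrite H ops resp t ver ver') :
    (resp t).version = ver' := by
  obtain ⟨_, _, _, hresp⟩ := h
  rw [hresp, Response.version]

theorem ReadReturns.version_eq {v : V} (h : ReadReturns ops resp t v ver) :
    (resp t).version = ver := by
  obtain ⟨_, hresp | hresp⟩ := h <;> rw [hresp, Response.version]

theorem ReadReturns.not_isWrite {v : V} (h : ReadReturns ops resp t v ver) :
    ¬ IsWrite H ops resp t := by
  rintro ⟨_, _, _, _, _, hwrite⟩
  obtain ⟨_, hread | hread⟩ := h <;> rw [hread] at hwrite <;> cases hwrite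

theorem RevisionChain.zero (a : Ver) : RevisionChain H ops resp 0 a a :=
  ⟨fun _ => a, rfl, rfl, by simp⟩

theorem RevisionChain.snoc {m : ℕ} {a b c : Ver} (h : RevisionChain H ops resp m a b)
    (ht : SuccWrite H ops resp t b c) : RevisionChain H ops resp (m + 1) a c := by
  obtain ⟨s, rfl, rfl, hs⟩ := h
  refine ⟨fun i => if i ≤ m then s i else c, by simp, by simp, fun i hi => ?_⟩
  rcases Nat.lt_succ_iff_lt_or_eq.1 hi with hlt | rfl
  · simpa [hlt.le, Nat.succ_le_of_lt hlt] using hs i hlt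
  · exact ⟨t, by simpa using ht⟩

section Graded

variable {grade : Ver → ℕ}

theorem RevisionChain.grade_eq
    (hgrade : ∀ t ver ver', SuccWrite H ops resp t ver ver' → grade ver' = grade ver + 1)
    {m : ℕ} {a b : Ver} (h : RevisionChain H ops resp m a b) : grade b = grade a + m := by
  obtain ⟨s, rfl, rfl, hs⟩ := h
  have hgrade_le : ∀ i ≤ m, grade (s i) = grade (s 0) + i := by
    intro i hi
    induction i with
    | zero => rfl
    | succ i ih =>
      obtain ⟨t, ht⟩ := hs i hi
      rw [hgrade t _ _ ht, ih (Nat.le_of_succ_le hi), Nat.add_assoc]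
  exact hgrade_le m le_rfl

theorem exists_revisionChain
    (hgrade : ∀ t ver ver', SuccWrite H ops resp t ver ver' → grade ver' = grade ver + 1)
    (hbase : ∀ t ver ver', SuccWrite H ops resp t ver ver' → ver ∈ Versions ver₀ H ops resp)
    (hver : ver ∈ Versions ver₀ H ops resp) : ∃ k, RevisionChain H ops resp k ver₀ ver := by
  induction hn : grade ver generalizing ver with
  | zero =>
    rcases hver with rfl | ⟨t, base, ht⟩
    · exact ⟨0, .zero ver⟩
    · cases hn.symm.trans (hgrade t base ver ht)
  | succ n ih =>
    rcases hver with rfl | ⟨t, base, ht⟩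
    · exact ⟨0, .zero ver⟩
    · obtain ⟨k, hk⟩ := ih (hbase t base ver ht)
        (Nat.succ_injective ((hgrade t base ver ht).symm.trans hn))
      exact ⟨k + 1, hk.snoc ht⟩

variable [LinearOrder Ver]

theorem isValid_of_grade (hmono : Monotone grade)
    (hgrade : ∀ t ver ver', SuccWrite H ops resp t ver ver' → grade ver' = grade ver + 1)
    (hbase : ∀ t ver ver', SuccWrite H ops resp t ver ver' → ver ∈ Versions ver₀ H ops resp)
    (hunique : ∀ t₁ t₂ a b ver, SuccWrite H ops resp t₁ a ver → SuccWrite H ops resp t₂ b ver →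
      t₁ = t₂) :
    IsValid ver₀ H ops resp where
  increasing t ver ver' h := hmono.reflect_lt (hgrade t ver ver' h ▸ Nat.lt_succ_self _)
  unique := by
    rintro t₁ t₂ a b ver _ hne h₁ h₂ rfl
    exact hne (hunique t₁ t₂ a b ver h₁ h₂)
  derived _ hver := exists_revisionChain hgrade hbase hver

theorem isWeaklyCoverable_versionLT (hmono : Monotone grade)
    (hgrade : ∀ t ver ver', SuccWrite H ops resp t ver ver' → grade ver' = grade ver + 1)
    (hvalid : IsValid ver₀ H ops resp)
    (hbase : ∀ t ver ver', SuccWrite H ops resp t ver ver' → ver ∈ Versions ver₀ H ops resp)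
    (hprecWrite : ∀ t₁ ∈ ops, ∀ t₂ ver ver', SuccWrite H ops resp t₂ ver ver' →
      Precedes H t₁ t₂ → (resp t₁).version ≤ ver) :
    IsWeaklyCoverable ver₀ H ops resp (VersionLT H ops resp) where
  consolidation t₁ t₂ a verᵢ verⱼ b h₁ h₂ hprec := by
    have hle : verᵢ ≤ verⱼ := h₁.version_eq ▸ hprecWrite t₁ h₁.mem_ops t₂ verⱼ b h₂ hprec
    refine ⟨hle, .inl ?_⟩
    rw [h₁.version_eq, h₂.version_eq]
    exact hle.trans_lt (hvalid.increasing t₂ verⱼ b h₂)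
  continuity t₂ ver ver' h₂ := by
    rcases hbase t₂ ver ver' h₂ with hver | ⟨t₁, a, h₁⟩
    · exact .inr hver
    · refine .inl ⟨t₁, a, h₁, .inl ?_⟩
      rw [h₁.version_eq, h₂.version_eq]
      exact hvalid.increasing t₂ ver ver' h₂
  evolution _ _ _ _ _ _ k l hk hl hkl := hmono.reflect_lt <| by
    rw [hk.grade_eq hgrade, hl.grade_eq hgrade]
    exact Nat.add_lt_add_left hkl _

end Graded

variable [LinearOrder Ver]

theorem VersionLT.trans {a b c : ℕ} (hab : VersionLT H ops resp a b)
    (hbc : VersionLT H ops resp b c) : VersionLT H ops resp a c := by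
  rcases hab with hab | ⟨hab, _, hb⟩ <;> rcases hbc with hbc | ⟨hbc, hb', _⟩
  · exact .inl (hab.trans hbc)
  · exact .inl (hbc ▸ hab)
  · exact .inl (hab ▸ hbc)
  · exact absurd hb' hb

theorem VersionLT.version_le {a b : ℕ} (h : VersionLT H ops resp a b) :
    (resp a).version ≤ (resp b).version := by
  rcases h with h | ⟨h, -, -⟩
  exacts [h.le, h.le]

theorem RevisionChain.le {m : ℕ} {a b : Ver} (hvalid : IsValid ver₀ H ops resp)
    (h : RevisionChain H ops resp m a b) : a ≤ b := by
  obtain ⟨s, rfl, rfl, hs⟩ := h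
  have hle : ∀ i ≤ m, s 0 ≤ s i := by
    intro i hi
    induction i with
    | zero => rfl
    | succ i ih =>
      obtain ⟨t, ht⟩ := hs i hi
      exact (ih (Nat.le_of_succ_le hi)).trans (hvalid.increasing t _ _ ht).le
  exact hle m le_rfl

theorem IsValid.eq_of_isWrite (hvalid : IsValid ver₀ H ops resp) (h₁ : IsWrite H ops resp t₁)
    (h₂ : IsWrite H ops resp t₂) (hver : (resp t₁).version = (resp t₂).version) : t₁ = t₂ := by
  obtain ⟨a, ver, h₁⟩ := h₁
  obtain ⟨b, ver', h₂⟩ := h₂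
  rw [h₁.version_eq, h₂.version_eq] at hver
  exact by_contra fun hne => hvalid.unique t₁ t₂ a b ver ver' hne h₁ h₂ hver

theorem IsValid.initial_lt_version (hvalid : IsValid ver₀ H ops resp)
    (hbase : ∀ t ver ver', SuccWrite H ops resp t ver ver' → ver ∈ Versions ver₀ H ops resp)
    (h : IsWrite H ops resp t) : ver₀ < (resp t).version := by
  obtain ⟨ver, ver', h⟩ := h
  obtain ⟨_, hchain⟩ := hvalid.derived ver (hbase t ver ver' h)
  rw [h.version_eq]
  exact (hchain.le hvalid).trans_lt (hvalid.increasing t ver ver' h)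

theorem isAtomic_versionLT (hvalid : IsValid ver₀ H ops resp)
    (hbase : ∀ t ver ver', SuccWrite H ops resp t ver ver' → ver ∈ Versions ver₀ H ops resp)
    (hprec : ∀ t₁ ∈ ops, ∀ t₂ ∈ ops, Precedes H t₁ t₂ →
      (resp t₁).version ≤ (resp t₂).version)
    (hprecWrite : ∀ t₁ ∈ ops, ∀ t₂ ver ver', SuccWrite H ops resp t₂ ver ver' →
      Precedes H t₁ t₂ → (resp t₁).version ≤ ver)
    (hread : ∀ t v ver, ReadReturns ops resp t v ver →
      (v = v₀ ∧ ver = ver₀) ∨ ∃ w ver', SuccWriteVal H ops resp w v ver' ver) :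
    IsAtomic ver₀ v₀ H ops resp (VersionLT H ops resp) where
  irrefl a _ h := by
    rcases h with h | ⟨_, ha, hna⟩
    exacts [lt_irrefl _ h, hna ha]
  trans _ _ _ _ _ _ := VersionLT.trans
  A1 a ha b hb hab hba := by
    rcases hba with hlt | ⟨heq, ⟨ver, ver', hwrite⟩, _⟩
    · exact (hprec a ha b hb hab).not_gt hlt
    · have hle : (resp a).version ≤ ver := hprecWrite a ha b ver ver' hwrite hab
      rw [← heq, hwrite.version_eq] at hle
      exact hle.not_gt (hvalid.increasing b ver ver' hwrite)
  A2 a _ b _ hwrite hne := by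
    rcases lt_trichotomy (resp a).version (resp b).version with hlt | heq | hgt
    · exact .inl (.inl hlt)
    · exact .inl (.inr ⟨heq, hwrite, fun hwrite' => hne (hvalid.eq_of_isWrite hwrite hwrite' heq)⟩)
    · exact .inr (.inl hgt)
  A3 t v ver ht := by
    rcases hread t v ver ht with ⟨rfl, rfl⟩ | ⟨w, ver', hw⟩
    · refine .inr ⟨fun w hw hlt => ?_, rfl, rfl⟩
      exact (ht.version_eq ▸ hlt.version_le).not_gt (hvalid.initial_lt_version hbase hw)
    · have hwrite : SuccWrite H ops resp w ver' ver := ⟨v, hw⟩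
      have hver : (resp w).version = (resp t).version := hwrite.version_eq.trans ht.version_eq.symm
      refine .inl ⟨w, ver', hw, .inr ⟨hver, hwrite.isWrite, ht.not_isWrite⟩, fun w' hw' hlt => ?_⟩
      rcases hlt.version_le.lt_or_eq with hlt | heq
      · exact .inr (.inl (hver ▸ hlt))
      · exact .inl (hvalid.eq_of_isWrite hw' hwrite.isWrite (heq.trans hver.symm))

end VersionedRegister

namespace VMWABD

open VersionedRegister

section Majorities

variable {P : Type*} {S : Finset P}

theorem IsMajority.mono {Q Q' : Set P} (h : IsMajority S Q) (hQ : ∀ r ∈ S, r ∈ Q → r ∈ Q') :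
    IsMajority S Q' := by
  refine lt_of_lt_of_le h (Nat.mul_le_mul_left 2 (Set.ncard_le_ncard ?_ ?_))
  · exact fun r hr => ⟨hr.1, hQ r hr.1 hr.2⟩
  · exact S.finite_toSet.inter_of_left _

theorem IsMajority.exists_mem_inter {Q Q' : Set P} (h : IsMajority S Q) (h' : IsMajority S Q') :
    ∃ r ∈ S, r ∈ Q ∧ r ∈ Q' := by
  by_contra! hne
  have hdisj : Disjoint ((S : Set P) ∩ Q) ((S : Set P) ∩ Q') :=
    Set.disjoint_left.2 fun r hr hr' => hne r hr.1 hr.2 hr'.2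
  have hunion := Set.ncard_union_eq hdisj (S.finite_toSet.inter_of_left _)
    (S.finite_toSet.inter_of_left _)
  have hle : (((S : Set P) ∩ Q) ∪ ((S : Set P) ∩ Q')).ncard ≤ (S : Set P).ncard :=
    Set.ncard_le_ncard (Set.union_subset Set.inter_subset_left Set.inter_subset_left)
      S.finite_toSet
  rw [Set.ncard_coe_finset] at hle
  unfold IsMajority at h h'
  omega

theorem IsMajority.exists_mem {Q : Set P} (h : IsMajority S Q) : ∃ r ∈ S, r ∈ Q := by
  obtain ⟨r, hr, hQ, -⟩ := h.exists_mem_inter h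
  exact ⟨r, hr, hQ⟩

end Majorities

section Phases

variable {P V : Type*}

/-- How the phase of a client can evolve as long as it neither invokes an operation nor
responds. -/
inductive Phase.EvolvesTo : Phase P V → Phase P V → Prop where
  | idle : Phase.idle.EvolvesTo .idle
  | query {req : Request V (Tag P)} {replies replies' : P → Option (Tag P × V)}
      (subset : ∀ r, replies r ≠ none → replies' r ≠ none) :
      (Phase.query req replies).EvolvesTo (.query req replies')
  | endQuery {req : Request V (Tag P)} {replies : P → Option (Tag P × V)} {τ : Tag P}
      {pair : Tag P × V} {acks : Finset P} :
      (Phase.query req replies).EvolvesTo (.propagation req τ pair acks)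
  | propagation {req : Request V (Tag P)} {τ : Tag P} {pair : Tag P × V} {acks acks' : Finset P}
      (subset : acks ⊆ acks') :
      (Phase.propagation req τ pair acks).EvolvesTo (.propagation req τ pair acks')

theorem Phase.EvolvesTo.refl : ∀ ph : Phase P V, ph.EvolvesTo ph
  | .idle => .idle
  | .query _ _ => .query fun _ => id
  | .propagation _ _ _ _ => .propagation (Finset.Subset.refl _)

theorem Phase.EvolvesTo.trans {ph ph' ph'' : Phase P V} (h : ph.EvolvesTo ph')
    (h' : ph'.EvolvesTo ph'') : ph.EvolvesTo ph'' := by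
  cases h with
  | idle => exact h'
  | query subset =>
    cases h' with
    | query subset' => exact .query fun r hr => subset' r (subset r hr)
    | endQuery => exact .endQuery
  | endQuery =>
    cases h' with
    | propagation => exact .endQuery
  | propagation subset =>
    cases h' with
    | propagation subset' => exact .propagation (subset.trans subset')

theorem Phase.EvolvesTo.ne_idle {ph ph' : Phase P V} (h : ph.EvolvesTo ph') (hph' : ph' ≠ .idle) :
    ph ≠ .idle := by
  rintro rfl
  cases h
  exact hph' rfl

end Phases

section ClientSteps

variable {P V : Type*} {S : Finset P}

theorem mem_broadcast {p r : P} (hr : r ∈ S) (n : ℕ) (body : Body P V) :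
    ⟨p, r, n, body⟩ ∈ broadcast S p n body :=
  Multiset.mem_map_of_mem _ hr

variable [LinearOrder P]

/-- The effect of a step on process `p` as a client. The step is seen as a transition, labelled by
the event that takes place in it, from a sequence number and phase to the next ones; `net` and
`net'` are the messages in transit before and after the step. -/
inductive ClientStep (S : Finset P) (net net' : Multiset (Msg P V)) (p : P) :
    Option (Event P V (Tag P)) → ℕ → Phase P V → ℕ → Phase P V → Prop where
  | rest {ev : Option (Event P V (Tag P))} (n : ℕ) (ph : Phase P V)
      (noEvent : ∀ e, ev = some e → e.proc ≠ p) : ClientStep S net net' p ev n ph n ph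
  | invoke (n : ℕ) (req : Request V (Tag P))
      (sent : ∀ r ∈ S, ⟨p, r, n + 1, .query⟩ ∈ net') :
      ClientStep S net net' p (some (.inv p req)) n .idle (n + 1) (.query req fun _ => none)
  | endQuery (n : ℕ) (req : Request V (Tag P)) (replies : P → Option (Tag P × V)) (τ : Tag P)
      (v : V) (majority : IsMajority S {r | replies r ≠ none}) (max : IsMaxReply S replies τ v)
      (sent : ∀ r ∈ S, ⟨p, r, n, .propagate (newPair p req τ v)⟩ ∈ net') :
      ClientStep S net net' p none n (.query req replies) n
        (.propagation req τ (newPair p req τ v) ∅)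
  | respond (n : ℕ) (req : Request V (Tag P)) (τ : Tag P) (pair : Tag P × V) (acks : Finset P)
      (majority : IsMajority S (acks : Set P)) :
      ClientStep S net net' p (some (.res p (response req τ pair))) n
        (.propagation req τ pair acks) n .idle
  | reply (n : ℕ) (req : Request V (Tag P)) (replies : P → Option (Tag P × V)) (r : P)
      (pair : Tag P × V) (transit : ⟨r, p, n, .queryReply pair⟩ ∈ net) :
      ClientStep S net net' p none n (.query req replies) n
        (.query req (Function.update replies r (some pair)))
  | ack (n : ℕ) (req : Request V (Tag P)) (τ : Tag P) (pair : Tag P × V) (acks : Finset P) (r : P)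
      (transit : ⟨r, p, n, .ack⟩ ∈ net) :
      ClientStep S net net' p none n (.propagation req τ pair acks) n
        (.propagation req τ pair (insert r acks))

theorem clientStep_receive {net net' : Multiset (Msg P V)} {m : Msg P V} (hm : m ∈ net)
    (st : ProcState P V) :
    ClientStep S net net' m.dst none st.seq st.phase (receive st m).1.seq
      (receive st m).1.phase := by
  obtain ⟨src, dst, n, body⟩ := m
  have ignored : ClientStep S net net' dst none st.seq st.phase st.seq st.phase :=
    .rest _ _ (by simp)
  cases body with
  | query => exact ignored
  | propagate pair => exact ignored
  | queryReply pair =>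
    obtain ⟨crashed, seq, _ | ⟨req, replies⟩ | _, stored⟩ := st
    case query =>
      by_cases hseq : n = seq
      · subst hseq
        simpa [receive] using ClientStep.reply n req replies src pair hm
      · simpa [receive, hseq] using ignored
    all_goals exact ignored
  | ack =>
    obtain ⟨crashed, seq, _ | _ | ⟨req, τ, pair, acks⟩, stored⟩ := st
    case propagation =>
      by_cases hseq : n = seq
      · subst hseq
        simpa [receive] using ClientStep.ack n req τ pair acks src hm
      · simpa [receive, hseq] using ignored
    all_goals exact ignored

theorem Step.clientStep {s s' : State P V} {a : Action P V} (h : Step S s a s') (p : P) :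
    ClientStep S s.net s'.net p a.event (s.proc p).seq (s.proc p).phase (s'.proc p).seq
      (s'.proc p).phase := by
  cases h with
  | invoke q req alive idle =>
    rcases eq_or_ne p q with rfl | hne
    · simp only [Function.update_self, idle, Action.event]
      exact .invoke _ req fun r hr => Multiset.mem_add.2 (.inr (mem_broadcast hr _ _))
    · simp only [Function.update_of_ne hne]
      exact .rest _ _ (by simpa [Action.event, Event.proc] using hne.symm)
  | endQuery q req replies τ v alive phase majority max =>
    rcases eq_or_ne p q with rfl | hne
    · simp only [Function.update_self, phase, Action.event]
      exact .endQuery _ req replies τ v majority max fun r hr =>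
        Multiset.mem_add.2 (.inr (mem_broadcast hr _ _))
    · simp only [Function.update_of_ne hne]
      exact .rest _ _ (by simp [Action.event])
  | respond q req τ pair acks alive phase majority =>
    rcases eq_or_ne p q with rfl | hne
    · simp only [Function.update_self, phase, Action.event]
      exact .respond _ req τ pair acks majority
    · simp only [Function.update_of_ne hne]
      exact .rest _ _ (by simpa [Action.event, Event.proc] using hne.symm)
  | deliver m rest transit alive =>
    rcases eq_or_ne p m.dst with rfl | hne
    · simp only [Function.update_self]
      exact clientStep_receive (by simp [transit]) _
    · simp only [Function.update_of_ne hne]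
      exact .rest _ _ (by simp [Action.event])
  | crash q =>
    rcases eq_or_ne p q with rfl | hne
    · simp only [Function.update_self]
      exact .rest _ _ (by simp [Action.event])
    · simp only [Function.update_of_ne hne]
      exact .rest _ _ (by simp [Action.event])

namespace ClientStep

variable {net net' : Multiset (Msg P V)} {p : P} {ev : Option (Event P V (Tag P))} {n n' : ℕ}
  {ph ph' : Phase P V} {req : Request V (Tag P)}

theorem seq_le (h : ClientStep S net net' p ev n ph n' ph') : n ≤ n' := by
  cases h with
  | invoke => exact Nat.le_succ n
  | _ => exact le_rfl

theorem evolvesTo_of_seq_eq (h : ClientStep S net net' p ev n ph n' ph') (hn : n' = n)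
    (hph' : ph' ≠ .idle) : ph.EvolvesTo ph' := by
  cases h with
  | rest => exact .refl _
  | invoke => exact absurd hn (Nat.succ_ne_self n)
  | endQuery => exact .endQuery
  | respond => exact absurd rfl hph'
  | reply _ _ replies r pair =>
    refine .query fun r' hr' => ?_
    rcases eq_or_ne r' r with rfl | hne
    · simp
    · rwa [Function.update_of_ne hne]
  | ack => exact .propagation (Finset.subset_insert _ _)

theorem seq_eq_and_evolvesTo (h : ClientStep S net net' p ev n ph n' ph')
    (hev : ∀ e, ev = some e → e.proc ≠ p) : n' = n ∧ ph.EvolvesTo ph' := by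
  rcases eq_or_ne ph' .idle with rfl | hph'
  · cases h with
    | rest => exact ⟨rfl, .refl _⟩
    | respond => exact absurd rfl (hev _ rfl)
  · have hn : n' = n := by
      cases h with
      | invoke => exact absurd rfl (hev _ rfl)
      | _ => rfl
    exact ⟨hn, h.evolvesTo_of_seq_eq hn hph'⟩

theorem invoked_or_ne_idle (h : ClientStep S net net' p ev n ph n' ph') (hph' : ph' ≠ .idle) :
    (∃ req, ev = some (.inv p req)) ∨ n' = n ∧ ph ≠ .idle := by
  cases h with
  | rest => exact .inr ⟨rfl, hph'⟩
  | invoke _ req => exact .inl ⟨req, rfl⟩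
  | respond => exact absurd rfl hph'
  | _ => exact .inr ⟨rfl, by simp⟩

theorem of_invoke (h : ClientStep S net net' p (some (.inv p req)) n ph n' ph') :
    ph = .idle ∧ n' = n + 1 ∧ ph' = .query req (fun _ => none) ∧
      ∀ r ∈ S, ⟨p, r, n', .query⟩ ∈ net' := by
  cases h with
  | rest _ _ noEvent => exact absurd rfl (noEvent _ rfl)
  | invoke _ _ sent => exact ⟨rfl, rfl, rfl, sent⟩

theorem of_respond {r : Response V (Tag P)}
    (h : ClientStep S net net' p (some (.res p r)) n ph n' ph') :
    ph' = .idle ∧ n' = n ∧ ∃ req τ pair acks, ph = .propagation req τ pair acks ∧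
      IsMajority S (acks : Set P) ∧ r = response req τ pair := by
  cases h with
  | rest _ _ noEvent => exact absurd rfl (noEvent _ rfl)
  | respond _ req τ pair acks majority =>
    exact ⟨rfl, rfl, req, τ, pair, acks, rfl, majority, rfl⟩

theorem query_cases {replies : P → Option (Tag P × V)}
    (h : ClientStep S net net' p ev n ph n' (.query req replies)) :
    (∀ r, replies r = none) ∨
      n' = n ∧ ∃ replies₀, ph = .query req replies₀ ∧ ∀ r pair, replies r = some pair →
        replies₀ r = some pair ∨ ⟨r, p, n, .queryReply pair⟩ ∈ net := by
  cases h with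
  | rest => exact .inr ⟨rfl, replies, rfl, fun _ _ => .inl⟩
  | invoke => exact .inl fun _ => rfl
  | reply _ _ replies₀ r pair transit =>
    refine .inr ⟨rfl, replies₀, rfl, fun r' pair' hr' => ?_⟩
    rcases eq_or_ne r' r with rfl | hne
    · rw [Function.update_self, Option.some_inj] at hr'
      exact .inr (hr' ▸ transit)
    · exact .inl (by rwa [Function.update_of_ne hne] at hr')

theorem propagation_cases {τ : Tag P} {pair : Tag P × V} {acks : Finset P}
    (h : ClientStep S net net' p ev n ph n' (.propagation req τ pair acks)) :
    n' = n ∧ ((acks = ∅ ∧ ∃ replies v, ph = .query req replies ∧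
        IsMajority S {r | replies r ≠ none} ∧ IsMaxReply S replies τ v ∧
        pair = newPair p req τ v ∧ ∀ r ∈ S, ⟨p, r, n, .propagate pair⟩ ∈ net') ∨
      ∃ acks₀, ph = .propagation req τ pair acks₀ ∧
        ∀ r ∈ acks, r ∈ acks₀ ∨ ⟨r, p, n, .ack⟩ ∈ net) := by
  cases h with
  | rest => exact ⟨rfl, .inr ⟨acks, rfl, fun _ => .inl⟩⟩
  | endQuery _ _ replies _ v majority max sent =>
    exact ⟨rfl, .inl ⟨rfl, replies, v, rfl, majority, max, rfl, sent⟩⟩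
  | ack _ _ _ _ acks₀ r transit =>
    refine ⟨rfl, .inr ⟨acks₀, rfl, fun r' hr' => ?_⟩⟩
    rcases Finset.mem_insert.1 hr' with rfl | hr'
    exacts [.inr transit, .inl hr']

end ClientStep

end ClientSteps

section ReplicaSteps

variable {P V : Type*} [LinearOrder P] {S : Finset P} {s s' : State P V} {a : Action P V}

theorem receive_pair_cases (st : ProcState P V) (m : Msg P V) :
    (receive st m).1.pair = st.pair ∨
      ∃ pair, m.body = .propagate pair ∧ st.pair.1 < pair.1 ∧ (receive st m).1.pair = pair := by
  obtain ⟨src, dst, n, body⟩ := m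
  cases body with
  | query => exact .inl rfl
  | propagate pair =>
    by_cases hlt : st.pair.1 < pair.1
    · exact .inr ⟨pair, rfl, hlt, if_pos hlt⟩
    · exact .inl (if_neg hlt)
  | queryReply pair =>
    left
    simp only [receive]
    split <;> (try split) <;> rfl
  | ack =>
    left
    simp only [receive]
    split <;> (try split) <;> rfl

theorem Step.pair_cases (h : Step S s a s') (r : P) :
    (s'.proc r).pair = (s.proc r).pair ∨
      ∃ p n pair, ⟨p, r, n, .propagate pair⟩ ∈ s.net ∧ (s.proc r).pair.1 < pair.1 ∧
        (s'.proc r).pair = pair := by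
  cases h with
  | deliver m rest transit alive =>
    rcases eq_or_ne r m.dst with rfl | hne
    · simp only [Function.update_self]
      refine (receive_pair_cases (s.proc m.dst) m).imp_right ?_
      rintro ⟨pair, hbody, hlt, hpair⟩
      have hm : m ∈ s.net := by simp [transit]
      exact ⟨m.src, m.seq, pair, hbody ▸ hm, hlt, hpair⟩
    · exact .inl (by simp only [Function.update_of_ne hne])
  | invoke q | endQuery q | respond q | crash q =>
    left
    rcases eq_or_ne r q with rfl | hne
    · simp only [Function.update_self]
    · simp only [Function.update_of_ne hne]

theorem Step.pair_mono (h : Step S s a s') (r : P) :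
    (s.proc r).pair.1 ≤ (s'.proc r).pair.1 := by
  rcases h.pair_cases r with heq | ⟨_, _, _, _, hlt, heq⟩
  · rw [heq]
  · exact heq ▸ hlt.le

/-- What holds of a message `m` that was sent in the step from `s` to `s'`. -/
def Msg.SentIn (m : Msg P V) (s s' : State P V) : Prop :=
  match m.body with
  | .query => m.seq = (s'.proc m.src).seq
  | .propagate pair =>
      m.seq = (s'.proc m.src).seq ∧ ∃ req τ, (s'.proc m.src).phase = .propagation req τ pair ∅
  | .queryReply pair => ⟨m.dst, m.src, m.seq, .query⟩ ∈ s.net ∧ pair = (s.proc m.src).pair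
  | .ack =>
      ∃ pair, ⟨m.dst, m.src, m.seq, .propagate pair⟩ ∈ s.net ∧ pair.1 ≤ (s'.proc m.src).pair.1

theorem mem_receive {st : ProcState P V} {m reply : Msg P V} (hreply : reply ∈ (receive st m).2) :
    reply.src = m.dst ∧ reply.dst = m.src ∧ reply.seq = m.seq ∧
      (m.body = .query ∧ reply.body = .queryReply st.pair ∨
        ∃ pair, m.body = .propagate pair ∧ reply.body = .ack ∧
          pair.1 ≤ (receive st m).1.pair.1) := by
  obtain ⟨src, dst, n, body⟩ := m
  cases body with
  | query =>
    obtain rfl := Multiset.mem_singleton.1 hreply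
    exact ⟨rfl, rfl, rfl, .inl ⟨rfl, rfl⟩⟩
  | propagate pair =>
    obtain rfl := Multiset.mem_singleton.1 hreply
    refine ⟨rfl, rfl, rfl, .inr ⟨pair, rfl, rfl, ?_⟩⟩
    simp only [receive]
    split
    exacts [le_rfl, not_lt.1 ‹_›]
  | queryReply pair =>
    simp only [receive] at hreply
    split at hreply <;> (try split at hreply) <;> simp at hreply
  | ack =>
    simp only [receive] at hreply
    split at hreply <;> (try split at hreply) <;> simp at hreply

theorem Step.mem_net (h : Step S s a s') {m : Msg P V} (hm : m ∈ s'.net) :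
    m ∈ s.net ∨ m.SentIn s s' := by
  cases h with
  | invoke q req =>
    refine (Multiset.mem_add.1 hm).imp_right fun hm => ?_
    obtain ⟨r, -, rfl⟩ := Multiset.mem_map.1 hm
    simp [Msg.SentIn]
  | endQuery q req replies τ v =>
    refine (Multiset.mem_add.1 hm).imp_right fun hm => ?_
    obtain ⟨r, -, rfl⟩ := Multiset.mem_map.1 hm
    simp [Msg.SentIn]
  | respond | crash => exact .inl hm
  | deliver received rest transit alive =>
    have hreceived : received ∈ s.net := by simp [transit]
    rcases Multiset.mem_add.1 hm with hm | hm
    · exact .inl (by simp [transit, hm])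
    · right
      obtain ⟨hsrc, hdst, hseq, ⟨hreceived_body, hbody⟩ | ⟨pair, hreceived_body, hbody, hle⟩⟩ :=
        mem_receive hm
      all_goals simp only [Msg.SentIn, hbody, hsrc, hdst, hseq, and_true]
      · exact hreceived_body ▸ hreceived
      · exact ⟨pair, hreceived_body ▸ hreceived, by simpa using hle⟩

end ReplicaSteps

section NewPair

variable {P V : Type*} [LinearOrder P] {p : P} {req : Request V (Tag P)} {τ : Tag P}

theorem lt_toLex_succ (τ : Tag P) (p : P) : τ < toLex ((ofLex τ).1 + 1, p) :=
  Prod.Lex.lt_iff.2 (.inl (Nat.lt_succ_self _))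

theorem newPair_write_self (p : P) (val : V) (τ : Tag P) (v : V) :
    newPair p (.write val τ) τ v = (toLex ((ofLex τ).1 + 1, p), val) :=
  if_pos rfl

theorem newPair_of_forall_ne (h : ∀ val, req ≠ .write val τ) (v : V) :
    newPair p req τ v = (τ, v) := by
  cases req with
  | read => rfl
  | write val ver => exact if_neg fun hver => h val (by rw [hver])

theorem le_newPair (p : P) (req : Request V (Tag P)) (τ : Tag P) (v : V) :
    τ ≤ (newPair p req τ v).1 := by
  by_cases hwrite : ∃ val, req = .write val τ
  · obtain ⟨val, rfl⟩ := hwrite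
    exact newPair_write_self p val τ v ▸ (lt_toLex_succ τ p).le
  · rw [newPair_of_forall_ne (not_exists.1 hwrite)]

theorem version_response (req : Request V (Tag P)) (τ : Tag P) (pair : Tag P × V) :
    (response req τ pair).version = pair.1 := by
  cases req <;> rfl

theorem eq_of_response {pair : Tag P × V} {v : V} {ver : Tag P}
    (h : response req τ pair = .read v ver ∨ response req τ pair = .write v ver .unchg) :
    pair = (ver, v) := by
  cases req with
  | read =>
    rcases h with h | h <;> cases h
    rfl
  | write =>
    rcases h with h | h
    · cases h
    · obtain ⟨rfl, rfl, -⟩ := Response.write.inj h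
      rfl

theorem admits_response_newPair (p : P) (req : Request V (Tag P)) (τ : Tag P) (v : V) :
    req.Admits (response req τ (newPair p req τ v)) := by
  cases req with
  | read => trivial
  | write val ver =>
    rcases eq_or_ne ver τ with rfl | hne
    · simp [newPair_write_self, response, Request.Admits]
    · simpa [newPair, response, Request.Admits, hne] using hne.symm

end NewPair

section Executions

variable {P V : Type*} [LinearOrder P] {S : Finset P} {τ₀ : Tag P} {v₀ : V}

namespace Execution

/-- The number of operations that `p` has invoked before step `u`. -/
abbrev seq (ξ : Execution S τ₀ v₀) (u : ℕ) (p : P) : ℕ := ((ξ.state u).proc p).seq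

/-- The phase of the client `p` before step `u`. -/
abbrev phase (ξ : Execution S τ₀ v₀) (u : ℕ) (p : P) : Phase P V := ((ξ.state u).proc p).phase

/-- The pair that the replica `r` stores before step `u`. -/
abbrev stored (ξ : Execution S τ₀ v₀) (u : ℕ) (r : P) : Tag P × V := ((ξ.state u).proc r).pair

/-- The messages in transit before step `u`. -/
abbrev net (ξ : Execution S τ₀ v₀) (u : ℕ) : Multiset (Msg P V) := (ξ.state u).net

variable {ξ : Execution S τ₀ v₀} {t u u' : ℕ} {p r : P} {req : Request V (Tag P)} {τ : Tag P}
  {pair : Tag P × V} {acks : Finset P} {replies : P → Option (Tag P × V)} {m : Msg P V}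

theorem phase_zero (ξ : Execution S τ₀ v₀) (p : P) : ξ.phase 0 p = .idle := by
  rw [phase, ξ.init, initial]

theorem stored_zero (ξ : Execution S τ₀ v₀) (r : P) : ξ.stored 0 r = (τ₀, v₀) := by
  rw [stored, ξ.init, initial]

theorem notMem_net_zero (ξ : Execution S τ₀ v₀) (m : Msg P V) : m ∉ ξ.net 0 := by
  rw [net, ξ.init]
  exact Multiset.notMem_zero m

theorem clientStep (ξ : Execution S τ₀ v₀) (u : ℕ) (p : P) :
    ClientStep S (ξ.net u) (ξ.net (u + 1)) p (ξ.history u) (ξ.seq u p) (ξ.phase u p)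
      (ξ.seq (u + 1) p) (ξ.phase (u + 1) p) := by
  rcases hact : ξ.act u with _ | a
  · simp only [history, net, seq, phase, hact, ξ.idle u hact, Option.bind_none]
    exact .rest _ _ nofun
  · simpa only [history, hact, Option.bind_some] using (ξ.step u a hact).clientStep p

theorem mem_net_succ (hm : m ∈ ξ.net (u + 1)) :
    m ∈ ξ.net u ∨ m.SentIn (ξ.state u) (ξ.state (u + 1)) := by
  rcases hact : ξ.act u with _ | a
  · exact .inl (by rwa [net, ξ.idle u hact] at hm)
  · exact (ξ.step u a hact).mem_net hm

theorem exists_sentIn (hm : m ∈ ξ.net u) : ∃ v < u, m.SentIn (ξ.state v) (ξ.state (v + 1)) := by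
  induction u with
  | zero => exact absurd hm (ξ.notMem_net_zero m)
  | succ u ih =>
    rcases mem_net_succ hm with hm | hsent
    · obtain ⟨v, hv, hsent⟩ := ih hm
      exact ⟨v, hv.trans (Nat.lt_succ_self u), hsent⟩
    · exact ⟨u, Nat.lt_succ_self u, hsent⟩

theorem seq_mono (ξ : Execution S τ₀ v₀) (p : P) : Monotone fun u => ξ.seq u p :=
  monotone_nat_of_le_succ fun u => (ξ.clientStep u p).seq_le

theorem stored_mono (ξ : Execution S τ₀ v₀) (r : P) : Monotone fun u => (ξ.stored u r).1 := by
  refine monotone_nat_of_le_succ fun u => ?_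
  rcases hact : ξ.act u with _ | a
  · rw [stored, stored, ξ.idle u hact]
  · exact (ξ.step u a hact).pair_mono r

theorem stored_eq_initial_or_exists_propagate (ξ : Execution S τ₀ v₀) (u : ℕ) (r : P) :
    ξ.stored u r = (τ₀, v₀) ∨ ∃ v < u, ∃ p n, ⟨p, r, n, .propagate (ξ.stored u r)⟩ ∈ ξ.net v := by
  induction u with
  | zero => exact .inl (ξ.stored_zero r)
  | succ u ih =>
    have hstep : ξ.stored (u + 1) r = ξ.stored u r ∨
        ∃ p n, ⟨p, r, n, .propagate (ξ.stored (u + 1) r)⟩ ∈ ξ.net u := by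
      rcases hact : ξ.act u with _ | a
      · exact .inl (by rw [stored, ξ.idle u hact])
      · refine ((ξ.step u a hact).pair_cases r).imp_right ?_
        rintro ⟨p, n, pair, hm, -, rfl⟩
        exact ⟨p, n, hm⟩
    rcases hstep with heq | hm
    · rw [heq]
      exact ih.imp_right fun ⟨v, hv, hm⟩ => ⟨v, hv.trans (Nat.lt_succ_self u), hm⟩
    · exact .inr ⟨u, Nat.lt_succ_self u, hm⟩

theorem evolvesTo_of_seq_eq (huu' : u ≤ u') (hseq : ξ.seq u p = ξ.seq u' p)
    (hphase : ξ.phase u' p ≠ .idle) : (ξ.phase u p).EvolvesTo (ξ.phase u' p) := by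
  induction u', huu' using Nat.le_induction with
  | base => exact .refl _
  | succ v huv ih =>
    have hseq_v : ξ.seq (v + 1) p = ξ.seq v p :=
      le_antisymm (hseq ▸ ξ.seq_mono p huv) (ξ.seq_mono p (Nat.le_succ v))
    have hstep := (ξ.clientStep v p).evolvesTo_of_seq_eq hseq_v hphase
    exact (ih (hseq.trans hseq_v) (hstep.ne_idle hphase)).trans hstep

theorem seq_eq_and_evolvesTo_of_no_event (huu' : u ≤ u')
    (hquiet : ∀ v, u ≤ v → v < u' → ∀ e, ξ.history v = some e → e.proc ≠ p) :
    ξ.seq u' p = ξ.seq u p ∧ (ξ.phase u p).EvolvesTo (ξ.phase u' p) := by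
  induction u', huu' using Nat.le_induction with
  | base => exact ⟨rfl, .refl _⟩
  | succ v huv ih =>
    obtain ⟨hseq, hevolves⟩ := ih fun w huw hwv => hquiet w huw (hwv.trans (Nat.lt_succ_self v))
    obtain ⟨hseq', hevolves'⟩ :=
      (ξ.clientStep v p).seq_eq_and_evolvesTo (hquiet v huv (Nat.lt_succ_self v))
    exact ⟨hseq'.trans hseq, hevolves.trans hevolves'⟩

theorem of_invokes (hinv : Invokes ξ.history t p req) :
    ξ.phase t p = .idle ∧ ξ.seq (t + 1) p = ξ.seq t p + 1 ∧
      ξ.phase (t + 1) p = .query req (fun _ => none) ∧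
      ∀ r ∈ S, ⟨p, r, ξ.seq (t + 1) p, .query⟩ ∈ ξ.net (t + 1) := by
  have hstep := ξ.clientStep t p
  rw [show ξ.history t = some (.inv p req) from hinv] at hstep
  exact hstep.of_invoke

theorem exists_invokes_of_ne_idle (hphase : ξ.phase u p ≠ .idle) :
    ∃ t < u, ∃ req, Invokes ξ.history t p req ∧ ξ.seq u p = ξ.seq (t + 1) p := by
  induction u with
  | zero => exact absurd (ξ.phase_zero p) hphase
  | succ u ih =>
    rcases (ξ.clientStep u p).invoked_or_ne_idle hphase with ⟨req, hinv⟩ | ⟨hseq, hphase⟩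
    · exact ⟨u, Nat.lt_succ_self u, req, hinv, rfl⟩
    · obtain ⟨t, ht, req, hinv, hseq'⟩ := ih hphase
      exact ⟨t, ht.trans (Nat.lt_succ_self u), req, hinv, hseq.trans hseq'⟩

/-! #### Where messages, replies and acks come from -/

theorem seq_le_of_query_mem_net {n : ℕ} (hm : ⟨p, r, n, .query⟩ ∈ ξ.net u) : n ≤ ξ.seq u p := by
  obtain ⟨v, hv, hseq⟩ := exists_sentIn hm
  exact (show n = ξ.seq (v + 1) p from hseq).trans_le (ξ.seq_mono p hv)

theorem exists_phase_of_propagate_mem_net {n : ℕ} (hm : ⟨p, r, n, .propagate pair⟩ ∈ ξ.net u) :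
    ∃ v ≤ u, ξ.seq v p = n ∧ ∃ req τ, ξ.phase v p = .propagation req τ pair ∅ := by
  obtain ⟨v, hv, hseq, hphase⟩ := exists_sentIn hm
  exact ⟨v + 1, hv, hseq.symm, hphase⟩

theorem exists_stored_of_queryReply_mem_net {n : ℕ}
    (hm : ⟨r, p, n, .queryReply pair⟩ ∈ ξ.net u) :
    ∃ v < u, n ≤ ξ.seq v p ∧ ξ.stored v r = pair := by
  obtain ⟨v, hv, hquery, hpair⟩ := exists_sentIn hm
  exact ⟨v, hv, seq_le_of_query_mem_net hquery, hpair.symm⟩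

theorem exists_stored_of_reply (hphase : ξ.phase u p = .query req replies)
    (hreply : replies r = some pair) : ∃ v < u, ξ.seq u p ≤ ξ.seq v p ∧ ξ.stored v r = pair := by
  induction u generalizing replies with
  | zero => cases (ξ.phase_zero p).symm.trans hphase
  | succ u ih =>
    have hstep := ξ.clientStep u p
    rw [hphase] at hstep
    rcases hstep.query_cases with hnone | ⟨hseq, replies₀, hphase₀, hreplies⟩
    · cases (hnone r).symm.trans hreply
    · rw [hseq]
      rcases hreplies r pair hreply with hreply₀ | hm
      · obtain ⟨v, hv, hstored⟩ := ih hphase₀ hreply₀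
        exact ⟨v, hv.trans (Nat.lt_succ_self u), hstored⟩
      · obtain ⟨v, hv, hstored⟩ := exists_stored_of_queryReply_mem_net hm
        exact ⟨v, hv.trans (Nat.lt_succ_self u), hstored⟩

theorem exists_query_of_propagation (hphase : ξ.phase u p = .propagation req τ pair acks) :
    ∃ v < u, ξ.seq v p = ξ.seq u p ∧ ∃ replies w, ξ.phase v p = .query req replies ∧
      IsMajority S {r | replies r ≠ none} ∧ IsMaxReply S replies τ w ∧
      pair = newPair p req τ w ∧ ∀ r ∈ S, ⟨p, r, ξ.seq v p, .propagate pair⟩ ∈ ξ.net (v + 1) := by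
  induction u generalizing acks with
  | zero => cases (ξ.phase_zero p).symm.trans hphase
  | succ u ih =>
    have hstep := ξ.clientStep u p
    rw [hphase] at hstep
    obtain ⟨hseq, ⟨-, hquery⟩ | ⟨acks₀, hphase₀, -⟩⟩ := hstep.propagation_cases
    · exact ⟨u, Nat.lt_succ_self u, hseq.symm, hquery⟩
    · obtain ⟨v, hv, hseq', hquery⟩ := ih hphase₀
      exact ⟨v, hv.trans (Nat.lt_succ_self u), hseq'.trans hseq.symm, hquery⟩

theorem le_stored_of_ack_mem_net (hphase : ξ.phase u p = .propagation req τ pair acks)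
    (hm : ⟨r, p, ξ.seq u p, .ack⟩ ∈ ξ.net u) : pair.1 ≤ (ξ.stored u r).1 := by
  obtain ⟨v, hv, pair', hpropagate, hle⟩ := exists_sentIn hm
  obtain ⟨v', hv', hseq, req', τ', hphase'⟩ := exists_phase_of_propagate_mem_net hpropagate
  have hevolves := evolvesTo_of_seq_eq (hv'.trans hv.le) hseq (by simp [hphase])
  rw [hphase, hphase'] at hevolves
  cases hevolves
  exact hle.trans (ξ.stored_mono r hv)

theorem le_stored_of_mem_acks (hphase : ξ.phase u p = .propagation req τ pair acks)
    (hr : r ∈ acks) : pair.1 ≤ (ξ.stored u r).1 := by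
  induction u generalizing acks with
  | zero => cases (ξ.phase_zero p).symm.trans hphase
  | succ u ih =>
    have hstep := ξ.clientStep u p
    rw [hphase] at hstep
    obtain ⟨-, ⟨rfl, -⟩ | ⟨acks₀, hphase₀, hacks⟩⟩ := hstep.propagation_cases
    · exact absurd hr (Finset.notMem_empty r)
    · refine le_trans ?_ (ξ.stored_mono r (Nat.le_succ u))
      rcases hacks r hr with hr₀ | hm
      · exact ih hphase₀ hr₀
      · exact le_stored_of_ack_mem_net hphase₀ hm

/-! #### Safety -/

theorem lt_of_seq_le (hinv : Invokes ξ.history t p req) (hseq : ξ.seq (t + 1) p ≤ ξ.seq u p) :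
    t < u := by
  obtain ⟨-, hsucc, -, -⟩ := of_invokes hinv
  exact (ξ.seq_mono p).reflect_lt (Nat.lt_of_succ_le (hsucc.symm.trans_le hseq))

theorem exists_respondsAt_of_event (hinv : Invokes ξ.history t p req) (htu : t < u)
    {e : Event P V (Tag P)} (he : ξ.history u = some e) (hproc : e.proc = p) :
    ∃ t' ≤ u, ∃ r, RespondsAt ξ.history t t' r := by
  classical
  have hexists : ∃ v, t < v ∧ ∃ e, ξ.history v = some e ∧ e.proc = p := ⟨u, htu, e, he, hproc⟩
  obtain ⟨htv, e', he', hproc'⟩ := Nat.find_spec hexists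
  have hv_le : Nat.find hexists ≤ u := Nat.find_min' hexists ⟨htu, e, he, hproc⟩
  have hquiet : ∀ w, t < w → w < Nat.find hexists → ∀ e, ξ.history w = some e → e.proc ≠ p :=
    fun w htw hw e he hproc => Nat.find_min hexists hw ⟨htw, e, he, hproc⟩
  generalize Nat.find hexists = v at *
  cases e' with
  | res q r =>
    obtain rfl : q = p := hproc'
    exact ⟨v, hv_le, r, q, req, hinv, htv, he', hquiet⟩
  | inv q req' =>
    obtain rfl : q = p := hproc'
    obtain ⟨-, hevolves⟩ := seq_eq_and_evolvesTo_of_no_event htv hquiet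
    obtain ⟨hidle, -⟩ := of_invokes he'
    obtain ⟨-, -, hquery, -⟩ := of_invokes hinv
    rw [hidle, hquery] at hevolves
    cases hevolves

theorem precedes_of_lt {t₁ t₂ : ℕ} {req₁ req₂ : Request V (Tag P)}
    (h₁ : Invokes ξ.history t₁ p req₁) (h₂ : Invokes ξ.history t₂ p req₂) (hlt : t₁ < t₂) :
    Precedes ξ.history t₁ t₂ := by
  obtain ⟨t', hle, r, hresp⟩ := exists_respondsAt_of_event h₁ hlt h₂ rfl
  refine ⟨t', r, hresp, hle.lt_of_ne ?_⟩
  rintro rfl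
  obtain ⟨q, _, _, _, hres, _⟩ := hresp
  cases h₂.symm.trans hres

/-- The operation that `p` invokes at step `t` with request `req` finds the tag `τ` in its query
phase and propagates `pair`. -/
def Proposes (ξ : Execution S τ₀ v₀) (t : ℕ) (p : P) (req : Request V (Tag P)) (τ : Tag P)
    (pair : Tag P × V) : Prop :=
  Invokes ξ.history t p req ∧
    ∃ u, ξ.seq u p = ξ.seq (t + 1) p ∧ ∃ acks, ξ.phase u p = .propagation req τ pair acks

theorem proposes_of_propagation (hphase : ξ.phase u p = .propagation req τ pair acks) :
    ∃ t, ξ.Proposes t p req τ pair := by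
  have hne_idle : ξ.phase u p ≠ .idle := by simp [hphase]
  obtain ⟨t, htu, req', hinv, hseq⟩ := exists_invokes_of_ne_idle hne_idle
  obtain ⟨-, -, hquery, -⟩ := of_invokes hinv
  have hevolves := evolvesTo_of_seq_eq htu hseq.symm hne_idle
  rw [hquery, hphase] at hevolves
  cases hevolves
  exact ⟨t, hinv, u, hseq, acks, hphase⟩

theorem Proposes.unique {q : P} {req' : Request V (Tag P)} {τ' : Tag P} {pair' : Tag P × V}
    (h : ξ.Proposes t p req τ pair) (h' : ξ.Proposes t q req' τ' pair') :
    req = req' ∧ τ = τ' ∧ pair = pair' := by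
  obtain ⟨hinv, u, hseq, acks, hphase⟩ := h
  obtain ⟨hinv', u', hseq', acks', hphase'⟩ := h'
  obtain ⟨rfl, -⟩ := hinv.unique hinv'
  rcases le_total u u' with hle | hle
  · have hevolves := evolvesTo_of_seq_eq hle (hseq.trans hseq'.symm) (by simp [hphase'])
    rw [hphase, hphase'] at hevolves
    cases hevolves
    exact ⟨rfl, rfl, rfl⟩
  · have hevolves := evolvesTo_of_seq_eq hle (hseq'.trans hseq.symm) (by simp [hphase])
    rw [hphase, hphase'] at hevolves
    cases hevolves
    exact ⟨rfl, rfl, rfl⟩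

theorem Proposes.le_of_isMajority {τ' : Tag P} (h : ξ.Proposes t p req τ pair)
    (hmajority : IsMajority S {r | τ' ≤ (ξ.stored t r).1}) : τ' ≤ τ := by
  obtain ⟨hinv, u, hseq, acks, hphase⟩ := h
  obtain ⟨v, -, hseq_v, replies, w, hquery, hreplies, hmax, -⟩ := exists_query_of_propagation hphase
  obtain ⟨r, hr, hreply, hstored⟩ := hreplies.exists_mem_inter hmajority
  obtain ⟨pair', hreply⟩ := Option.ne_none_iff_exists'.1 hreply
  obtain ⟨v', -, hle, rfl⟩ := exists_stored_of_reply hquery hreply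
  have htv' : t < v' := lt_of_seq_le hinv ((hseq.symm.trans hseq_v.symm).trans_le hle)
  calc τ' ≤ (ξ.stored t r).1 := hstored
    _ ≤ (ξ.stored v' r).1 := ξ.stored_mono r htv'.le
    _ ≤ τ := hmax.2 r hr _ _ hreply

theorem exists_proposes_of_respondsAt {t' : ℕ} {resp : Response V (Tag P)}
    (h : RespondsAt ξ.history t t' resp) :
    ∃ p req τ pair, ξ.Proposes t p req τ pair ∧ resp = response req τ pair ∧
      IsMajority S {r | pair.1 ≤ (ξ.stored t' r).1} := by
  obtain ⟨p, req, hinv, htt', hres, hquiet⟩ := h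
  obtain ⟨hseq, hevolves⟩ := seq_eq_and_evolvesTo_of_no_event htt' hquiet
  have hstep := ξ.clientStep t' p
  rw [hres] at hstep
  obtain ⟨-, -, req', τ, pair, acks, hphase, hmajority, rfl⟩ := hstep.of_respond
  obtain ⟨-, -, hquery, -⟩ := of_invokes hinv
  rw [hquery, hphase] at hevolves
  cases hevolves
  exact ⟨p, req, τ, pair, ⟨hinv, t', hseq, acks, hphase⟩, rfl,
    hmajority.mono fun r _ hr => le_stored_of_mem_acks hphase hr⟩

theorem Proposes.le_of_precedes {t₁ t₂ : ℕ} {p₁ p₂ : P} {req₁ req₂ : Request V (Tag P)}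
    {τ₁ τ₂ : Tag P} {pair₁ pair₂ : Tag P × V} (h₁ : ξ.Proposes t₁ p₁ req₁ τ₁ pair₁)
    (h₂ : ξ.Proposes t₂ p₂ req₂ τ₂ pair₂) (hprec : Precedes ξ.history t₁ t₂) : pair₁.1 ≤ τ₂ := by
  obtain ⟨t', resp, hresp, hlt⟩ := hprec
  obtain ⟨_, _, _, _, hproposes, -, hmajority⟩ := exists_proposes_of_respondsAt hresp
  obtain ⟨-, -, rfl⟩ := h₁.unique hproposes
  exact h₂.le_of_isMajority (hmajority.mono fun r _ hr => hr.trans (ξ.stored_mono r hlt.le))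

/-- The initial pair and the pairs created by successful writes. -/
def Written (ξ : Execution S τ₀ v₀) (pair : Tag P × V) : Prop :=
  pair = (τ₀, v₀) ∨ ∃ t p val τ, ξ.Proposes t p (.write val τ) τ pair

theorem exists_stored_of_propagation (hphase : ξ.phase u p = .propagation req τ pair acks) :
    ∃ v < u, ∃ r w, ξ.stored v r = (τ, w) ∧ pair = newPair p req τ w := by
  obtain ⟨v, hv, -, replies, w, hquery, -, ⟨⟨r, -, hreply⟩, -⟩, hpair, -⟩ :=
    exists_query_of_propagation hphase
  obtain ⟨v', hv', -, hstored⟩ := exists_stored_of_reply hquery hreply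
  exact ⟨v', hv'.trans hv, r, w, hstored, hpair⟩

theorem Proposes.written_of_written {w : V} (h : ξ.Proposes t p req τ (newPair p req τ w))
    (hw : ξ.Written (τ, w)) : ξ.Written (newPair p req τ w) := by
  by_cases hwrite : ∃ val, req = .write val τ
  · obtain ⟨val, rfl⟩ := hwrite
    exact .inr ⟨t, p, val, τ, h⟩
  · rwa [newPair_of_forall_ne (not_exists.1 hwrite)]

theorem written_stored (ξ : Execution S τ₀ v₀) (u : ℕ) (r : P) : ξ.Written (ξ.stored u r) := by
  induction u using Nat.strong_induction_on generalizing r with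
  | h u ih =>
    rcases ξ.stored_eq_initial_or_exists_propagate u r with hinit | ⟨v, hv, p, n, hm⟩
    · exact .inl hinit
    · obtain ⟨v', hv', -, req, τ, hphase⟩ := exists_phase_of_propagate_mem_net hm
      obtain ⟨t, hproposes⟩ := proposes_of_propagation hphase
      obtain ⟨v'', hv'', r', w, hstored, hpair⟩ := exists_stored_of_propagation hphase
      rw [hpair] at hproposes ⊢
      exact hproposes.written_of_written (hstored ▸ ih v'' (hv''.trans_le hv' |>.trans hv) r')

theorem Proposes.exists_written (h : ξ.Proposes t p req τ pair) :
    ∃ w, ξ.Written (τ, w) ∧ pair = newPair p req τ w := by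
  obtain ⟨-, u, -, acks, hphase⟩ := h
  obtain ⟨v, -, r, w, hstored, hpair⟩ := exists_stored_of_propagation hphase
  exact ⟨w, hstored ▸ ξ.written_stored v r, hpair⟩

theorem Proposes.written (h : ξ.Proposes t p req τ pair) : ξ.Written pair := by
  obtain ⟨w, hw, rfl⟩ := h.exists_written
  exact h.written_of_written hw

theorem Proposes.le_pair (h : ξ.Proposes t p req τ pair) : τ ≤ pair.1 := by
  obtain ⟨w, -, rfl⟩ := h.exists_written
  exact le_newPair p req τ w

theorem Proposes.write_eq {val : V} (h : ξ.Proposes t p (.write val τ) τ pair) :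
    pair = (toLex ((ofLex τ).1 + 1, p), val) := by
  obtain ⟨w, -, rfl⟩ := h.exists_written
  exact newPair_write_self p val τ w

theorem Proposes.not_lt_of_write {t₁ t₂ : ℕ} {req₁ : Request V (Tag P)} {val₂ : V}
    {τ₁ τ₂ : Tag P} {pair₁ pair₂ : Tag P × V} (h₁ : ξ.Proposes t₁ p req₁ τ₁ pair₁)
    (h₂ : ξ.Proposes t₂ p (.write val₂ τ₂) τ₂ pair₂) (heq : pair₁.1 = pair₂.1) : ¬ t₁ < t₂ := by
  intro hlt
  have hle : pair₁.1 ≤ τ₂ := h₁.le_of_precedes h₂ (precedes_of_lt h₁.1 h₂.1 hlt)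
  rw [heq, h₂.write_eq] at hle
  exact hle.not_gt (lt_toLex_succ τ₂ p)

theorem Proposes.write_unique {t₁ t₂ : ℕ} {p₁ p₂ : P} {val₁ val₂ : V} {τ₁ τ₂ : Tag P}
    {pair₁ pair₂ : Tag P × V} (h₁ : ξ.Proposes t₁ p₁ (.write val₁ τ₁) τ₁ pair₁)
    (h₂ : ξ.Proposes t₂ p₂ (.write val₂ τ₂) τ₂ pair₂) (heq : pair₁.1 = pair₂.1) : t₁ = t₂ := by
  have hwriter : p₁ = p₂ := by
    rw [h₁.write_eq, h₂.write_eq] at heq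
    exact (Prod.mk.inj (toLex.injective heq)).2
  subst hwriter
  exact le_antisymm (not_lt.1 (h₂.not_lt_of_write h₁ heq.symm))
    (not_lt.1 (h₁.not_lt_of_write h₂ heq))

/-- The completion of the history consists of the operations that reach their propagation
phase. -/
def ops (ξ : Execution S τ₀ v₀) : Set ℕ :=
  {t | ∃ p req τ pair, ξ.Proposes t p req τ pair}

open Classical in
/-- The response that an operation in `ξ.ops` gives as soon as its propagation phase ends. -/
noncomputable def resp (ξ : Execution S τ₀ v₀) (t : ℕ) : Response V (Tag P) :=
  if h : ∃ resp p req τ pair, ξ.Proposes t p req τ pair ∧ resp = response req τ pair then h.choose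
  else .read v₀ τ₀

theorem Proposes.mem_ops (h : ξ.Proposes t p req τ pair) : t ∈ ξ.ops := ⟨p, req, τ, pair, h⟩

theorem Proposes.resp_eq (h : ξ.Proposes t p req τ pair) : ξ.resp t = response req τ pair := by
  have hexists : ∃ resp p req τ pair, ξ.Proposes t p req τ pair ∧ resp = response req τ pair :=
    ⟨_, p, req, τ, pair, h, rfl⟩
  obtain ⟨_, _, _, _, h', heq⟩ := hexists.choose_spec
  obtain ⟨rfl, rfl, rfl⟩ := h.unique h'
  rw [resp, dif_pos hexists, heq]

theorem Proposes.version_resp (h : ξ.Proposes t p req τ pair) : (ξ.resp t).version = pair.1 := by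
  rw [h.resp_eq, version_response]

theorem succWriteVal_iff {v : V} {ver ver' : Tag P} :
    SuccWriteVal ξ.history ξ.ops ξ.resp t v ver ver' ↔
      ∃ p, ξ.Proposes t p (.write v ver) ver (ver', v) := by
  constructor
  · rintro ⟨⟨p, req, τ, pair, h⟩, ⟨q, hinv⟩, hresp⟩
    obtain ⟨rfl, rfl⟩ := h.1.unique hinv
    rw [h.resp_eq, response] at hresp
    obtain ⟨rfl, rfl, hflag⟩ := Response.write.inj hresp
    obtain rfl : ver = τ := by_contra fun hne => by simp [hne] at hflag
    exact ⟨p, h⟩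
  · rintro ⟨p, h⟩
    exact ⟨h.mem_ops, ⟨p, h.1⟩, by rw [h.resp_eq, response, if_pos rfl]⟩

theorem Written.eq_initial_or_exists_succWriteVal {v : V} {ver : Tag P} (h : ξ.Written (ver, v)) :
    (v = v₀ ∧ ver = τ₀) ∨
      ∃ w ver', SuccWriteVal ξ.history ξ.ops ξ.resp w v ver' ver := by
  rcases h with hinit | ⟨t, p, val, τ, h⟩
  · exact .inl (Prod.mk.inj hinit).symm
  · obtain rfl : v = val := (Prod.mk.inj h.write_eq).2
    exact .inr ⟨t, τ, succWriteVal_iff.2 ⟨p, h⟩⟩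

theorem Written.mem_versions {v : V} {ver : Tag P} (h : ξ.Written (ver, v)) :
    ver ∈ Versions τ₀ ξ.history ξ.ops ξ.resp :=
  h.eq_initial_or_exists_succWriteVal.imp And.right fun ⟨w, ver', hw⟩ => ⟨w, ver', v, hw⟩

theorem isCompletion (ξ : Execution S τ₀ v₀) : IsCompletion ξ.history ξ.ops ξ.resp where
  invoked := fun _ ⟨p, req, _, _, h⟩ => ⟨p, req, h.1⟩
  complete t t' r hresp := by
    obtain ⟨p, req, τ, pair, h, rfl, -⟩ := exists_proposes_of_respondsAt hresp
    exact ⟨h.mem_ops, h.resp_eq⟩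

theorem wellTyped (ξ : Execution S τ₀ v₀) : WellTyped ξ.history ξ.ops ξ.resp := by
  rintro t ⟨p, req, τ, pair, h⟩ q i hinv
  obtain ⟨-, rfl⟩ := h.1.unique hinv
  obtain ⟨w, -, rfl⟩ := h.exists_written
  exact h.resp_eq ▸ admits_response_newPair p req τ w

theorem grade_eq_of_succWrite {ver ver' : Tag P}
    (h : SuccWrite ξ.history ξ.ops ξ.resp t ver ver') :
    (ofLex ver').1 = (ofLex ver).1 + 1 := by
  obtain ⟨v, hv⟩ := h
  obtain ⟨p, h⟩ := succWriteVal_iff.1 hv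
  rw [(Prod.mk.inj h.write_eq).1, ofLex_toLex]

theorem mem_versions_of_succWrite {ver ver' : Tag P}
    (h : SuccWrite ξ.history ξ.ops ξ.resp t ver ver') :
    ver ∈ Versions τ₀ ξ.history ξ.ops ξ.resp := by
  obtain ⟨v, hv⟩ := h
  obtain ⟨p, h⟩ := succWriteVal_iff.1 hv
  obtain ⟨w, hw, -⟩ := h.exists_written
  exact hw.mem_versions

theorem isValid (ξ : Execution S τ₀ v₀) : IsValid τ₀ ξ.history ξ.ops ξ.resp := by
  refine isValid_of_grade Prod.Lex.monotone_fst_ofLex (fun _ _ _ => grade_eq_of_succWrite)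
    (fun _ _ _ => mem_versions_of_succWrite) ?_
  rintro t₁ t₂ a b ver ⟨v₁, h₁⟩ ⟨v₂, h₂⟩
  obtain ⟨p₁, h₁⟩ := succWriteVal_iff.1 h₁
  obtain ⟨p₂, h₂⟩ := succWriteVal_iff.1 h₂
  exact h₁.write_unique h₂ rfl

theorem version_le_of_precedes {t₁ t₂ : ℕ} (h₁ : t₁ ∈ ξ.ops) (h₂ : t₂ ∈ ξ.ops)
    (hprec : Precedes ξ.history t₁ t₂) : (ξ.resp t₁).version ≤ (ξ.resp t₂).version := by
  obtain ⟨p₁, req₁, τ₁, pair₁, h₁⟩ := h₁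
  obtain ⟨p₂, req₂, τ₂, pair₂, h₂⟩ := h₂
  rw [h₁.version_resp, h₂.version_resp]
  exact (h₁.le_of_precedes h₂ hprec).trans h₂.le_pair

theorem version_le_of_precedes_succWrite {t₁ t₂ : ℕ} {ver ver' : Tag P} (h₁ : t₁ ∈ ξ.ops)
    (h₂ : SuccWrite ξ.history ξ.ops ξ.resp t₂ ver ver') (hprec : Precedes ξ.history t₁ t₂) :
    (ξ.resp t₁).version ≤ ver := by
  obtain ⟨p₁, req₁, τ₁, pair₁, h₁⟩ := h₁
  obtain ⟨v, h₂⟩ := h₂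
  obtain ⟨p₂, h₂⟩ := succWriteVal_iff.1 h₂
  rw [h₁.version_resp]
  exact h₁.le_of_precedes h₂ hprec

theorem written_of_readReturns {v : V} {ver : Tag P} (h : ReadReturns ξ.ops ξ.resp t v ver) :
    ξ.Written (ver, v) := by
  obtain ⟨⟨p, req, τ, pair, hproposes⟩, hresp⟩ := h
  rw [hproposes.resp_eq] at hresp
  exact eq_of_response hresp ▸ hproposes.written

theorem isWeaklyCoverableAtomic (ξ : Execution S τ₀ v₀) :
    IsWeaklyCoverableAtomic τ₀ v₀ ξ.history := by
  refine ⟨ξ.ops, ξ.resp, VersionLT ξ.history ξ.ops ξ.resp, ξ.isCompletion, ξ.wellTyped, ?_,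
    ξ.isValid, ?_⟩
  · exact isAtomic_versionLT ξ.isValid (fun _ _ _ => mem_versions_of_succWrite)
      (fun _ h₁ _ h₂ => version_le_of_precedes h₁ h₂)
      (fun _ h₁ _ _ _ h₂ => version_le_of_precedes_succWrite h₁ h₂)
      fun _ _ _ h => (written_of_readReturns h).eq_initial_or_exists_succWriteVal
  · exact isWeaklyCoverable_versionLT Prod.Lex.monotone_fst_ofLex
      (fun _ _ _ => grade_eq_of_succWrite) ξ.isValid (fun _ _ _ => mem_versions_of_succWrite)
      fun _ h₁ _ _ _ h₂ => version_le_of_precedes_succWrite h₁ h₂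

end Execution

/-! #### Termination -/

variable {s s' : State P V} {a : Action P V} {p r : P} {n : ℕ}

theorem receive_crashed (st : ProcState P V) (m : Msg P V) :
    (receive st m).1.crashed = st.crashed := by
  unfold receive
  split
  · rfl
  · rfl
  · split <;> (try split) <;> rfl
  · split <;> (try split) <;> rfl

theorem Step.crashed (h : Step S s a s') (hp : (s'.proc p).crashed) :
    (s.proc p).crashed ∨ a = .crash p := by
  cases h with
  | deliver m =>
    left
    rcases eq_or_ne p m.dst with rfl | hne
    · simpa only [Function.update_self, receive_crashed] using hp
    · simpa only [Function.update_of_ne hne] using hp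
  | crash q =>
    rcases eq_or_ne p q with rfl | hne
    · exact .inr rfl
    · exact .inl (by simpa only [Function.update_of_ne hne] using hp)
  | invoke q | endQuery q | respond q =>
    left
    rcases eq_or_ne p q with rfl | hne
    · simpa only [Function.update_self] using hp
    · simpa only [Function.update_of_ne hne] using hp

theorem Step.queryReply_mem_net (h : Step S s (.deliver ⟨p, r, n, .query⟩) s') :
    ⟨r, p, n, .queryReply (s.proc r).pair⟩ ∈ s'.net := by
  cases h with
  | deliver => simp [receive]

theorem Step.ack_mem_net {pair : Tag P × V}
    (h : Step S s (.deliver ⟨p, r, n, .propagate pair⟩) s') : ⟨r, p, n, .ack⟩ ∈ s'.net := by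
  cases h with
  | deliver => simp [receive]

theorem Step.reply_of_deliver {pair : Tag P × V} {req : Request V (Tag P)}
    {replies : P → Option (Tag P × V)}
    (h : Step S s (.deliver ⟨r, p, (s.proc p).seq, .queryReply pair⟩) s')
    (hphase : (s'.proc p).phase = .query req replies) : replies r = some pair := by
  cases h with
  | deliver =>
    simp only [receive, Function.update_self, if_true] at hphase
    split at hphase
    · obtain ⟨-, rfl⟩ := Phase.query.inj hphase
      exact Function.update_self ..
    next hne => exact absurd hphase (hne _ _)

theorem Step.mem_acks_of_deliver {req : Request V (Tag P)} {τ : Tag P} {pair : Tag P × V}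
    {acks : Finset P} (h : Step S s (.deliver ⟨r, p, (s.proc p).seq, .ack⟩) s')
    (hphase : (s'.proc p).phase = .propagation req τ pair acks) : r ∈ acks := by
  cases h with
  | deliver =>
    simp only [receive, Function.update_self, if_true] at hphase
    split at hphase
    · obtain ⟨-, -, -, rfl⟩ := Phase.propagation.inj hphase
      exact Finset.mem_insert_self ..
    next hne => exact absurd hphase (hne _ _ _ _)

theorem Step.phase_of_isLocal (h : Step S s a s') (ha : a.IsLocal p) :
    (∃ req replies, (s.proc p).phase = .query req replies) ∧
        (∃ req τ pair acks, (s'.proc p).phase = .propagation req τ pair acks) ∨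
      (∃ req τ pair acks, (s.proc p).phase = .propagation req τ pair acks) ∧
        (s'.proc p).phase = .idle := by
  rcases ha with rfl | ⟨r, rfl⟩
  · cases h with
    | endQuery _ req replies τ v _ phase =>
      exact .inl ⟨⟨req, replies, phase⟩, req, τ, newPair p req τ v, ∅,
        by simp only [Function.update_self]⟩
  · cases h with
    | respond _ req τ pair acks _ phase =>
      exact .inr ⟨⟨req, τ, pair, acks, phase⟩, by simp only [Function.update_self]⟩

theorem exists_isMaxReply {replies : P → Option (Tag P × V)}
    (h : ∃ r ∈ S, replies r ≠ none) : ∃ τ v, IsMaxReply S replies τ v := by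
  classical
  obtain ⟨r₀, hr₀, hreply₀⟩ := h
  obtain ⟨pair₀, -⟩ := Option.ne_none_iff_exists'.1 hreply₀
  obtain ⟨r, hr, hmax⟩ := Finset.exists_max_image {r ∈ S | replies r ≠ none}
    (fun r => ((replies r).getD pair₀).1) ⟨r₀, Finset.mem_filter.2 ⟨hr₀, hreply₀⟩⟩
  obtain ⟨hrS, hreply⟩ := Finset.mem_filter.1 hr
  obtain ⟨⟨τ, v⟩, hpair⟩ := Option.ne_none_iff_exists'.1 hreply
  refine ⟨τ, v, ⟨r, hrS, hpair⟩, fun r' hr' τ' v' hpair' => ?_⟩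
  simpa [hpair, hpair'] using hmax r' (by simp [hr', hpair'])

namespace Execution

open Filter

variable {ξ : Execution S τ₀ v₀} {u : ℕ}

theorem Correct.not_crashed (hp : ξ.Correct p) (u : ℕ) : ¬ ((ξ.state u).proc p).crashed := by
  induction u with
  | zero => simp [ξ.init, initial]
  | succ u ih =>
    rcases hact : ξ.act u with _ | a
    · rwa [ξ.idle u hact]
    · intro hcrashed
      rcases (ξ.step u a hact).crashed hcrashed with h | rfl
      exacts [ih h, hp u hact]

theorem seq_eq_of_le {v : ℕ} (hvu : v ≤ u) (hle : n ≤ ξ.seq v p) (hseq : ξ.seq u p = n) :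
    ξ.seq v p = n :=
  le_antisymm (hseq ▸ ξ.seq_mono p hvu) hle

namespace Fair

theorem frequently_isLocal (hfair : ξ.Fair) (hp : ξ.Correct p)
    (henabled : ∀ᶠ u in atTop, ∃ a s', a.IsLocal p ∧ Step S (ξ.state u) a s') :
    ∃ᶠ u in atTop, ∃ a, a.IsLocal p ∧ Step S (ξ.state u) a (ξ.state (u + 1)) := by
  refine frequently_atTop.2 fun T => ?_
  obtain ⟨T', hT'⟩ := eventually_atTop.1 henabled
  obtain ⟨u, hu, ⟨a, ha, hact⟩ | hdisabled⟩ := hfair.localStep p hp (max T T')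
  · exact ⟨u, (le_max_left _ _).trans hu, a, ha, ξ.step u a hact⟩
  · exact absurd (hT' u ((le_max_right _ _).trans hu)) hdisabled

theorem eventually_reply (hfair : ξ.Fair) (hp : ξ.Correct p) (hr : ξ.Correct r)
    (hm : ⟨p, r, n, .query⟩ ∈ ξ.net u) :
    ∀ᶠ u' in atTop, ξ.seq u' p = n → ∀ req replies, ξ.phase u' p = .query req replies →
      replies r ≠ none := by
  obtain ⟨v, huv, hquery⟩ := hfair.deliver _ hp hr u hm
  obtain ⟨w, hvw, hreply⟩ :=
    hfair.deliver _ hr hp (v + 1) (ξ.step v _ hquery).queryReply_mem_net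
  filter_upwards [eventually_ge_atTop (w + 1)] with u' hwu' hseq req replies hphase
  have hle : n ≤ ξ.seq w p :=
    (seq_le_of_query_mem_net hm).trans (ξ.seq_mono p (huv.trans (Nat.le_of_succ_le hvw)))
  have hseq_w := seq_eq_of_le (Nat.le_of_succ_le hwu') hle hseq
  have hseq_w' := seq_eq_of_le hwu' (hle.trans (ξ.seq_mono p (Nat.le_succ w))) hseq
  have hevolves := evolvesTo_of_seq_eq hwu' (hseq_w'.trans hseq.symm) (by simp [hphase])
  rw [← hseq_w] at hreply
  rw [hphase] at hevolves
  generalize hphase_w : ξ.phase (w + 1) p = ph at hevolves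
  cases hevolves with
  | query subset => exact subset r (by simp [(ξ.step w _ hreply).reply_of_deliver hphase_w])

theorem eventually_mem_acks (hfair : ξ.Fair) (hp : ξ.Correct p) (hr : ξ.Correct r)
    {pair : Tag P × V} (hm : ⟨p, r, n, .propagate pair⟩ ∈ ξ.net u) :
    ∀ᶠ u' in atTop, ξ.seq u' p = n → ∀ req τ pair acks,
      ξ.phase u' p = .propagation req τ pair acks → r ∈ acks := by
  obtain ⟨t, htu, hseq_t, req₀, τ₀, hphase_t⟩ := exists_phase_of_propagate_mem_net hm
  obtain ⟨v, huv, hpropagate⟩ := hfair.deliver _ hp hr u hm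
  obtain ⟨w, hvw, hack⟩ := hfair.deliver _ hr hp (v + 1) (ξ.step v _ hpropagate).ack_mem_net
  filter_upwards [eventually_ge_atTop (w + 1)] with u' hwu' hseq req τ pair acks hphase
  have htw : t ≤ w := htu.trans (huv.trans (Nat.le_of_succ_le hvw))
  have hle : n ≤ ξ.seq w p := hseq_t.symm.trans_le (ξ.seq_mono p htw)
  have hseq_w := seq_eq_of_le (Nat.le_of_succ_le hwu') hle hseq
  have hseq_w' := seq_eq_of_le hwu' (hle.trans (ξ.seq_mono p (Nat.le_succ w))) hseq
  have hevolves := evolvesTo_of_seq_eq hwu' (hseq_w'.trans hseq.symm) (by simp [hphase])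
  have hevolves_t := evolvesTo_of_seq_eq (Nat.le_succ_of_le htw) (hseq_t.trans hseq_w'.symm)
    (hevolves.ne_idle (by simp [hphase]))
  rw [← hseq_w] at hack
  rw [hphase_t] at hevolves_t
  rw [hphase] at hevolves
  generalize hphase_w : ξ.phase (w + 1) p = ph at hevolves hevolves_t
  cases hevolves_t
  cases hevolves with
  | propagation subset => exact subset ((ξ.step w _ hack).mem_acks_of_deliver hphase_w)

theorem not_eventually_query (hfair : ξ.Fair) (hmaj : IsMajority S {r | ξ.Correct r})
    (hp : ξ.Correct p) (hm : ∀ r ∈ S, ⟨p, r, n, .query⟩ ∈ ξ.net u) :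
    ¬ ∀ᶠ u' in atTop, ξ.seq u' p = n ∧ ∃ req replies, ξ.phase u' p = .query req replies := by
  intro hquery
  have hreplies := (eventually_all_finset S).2 fun r hr => eventually_imp_distrib_left.2
    fun hcorrect : ξ.Correct r => hfair.eventually_reply hp hcorrect (hm r hr)
  have henabled : ∀ᶠ u' in atTop, ∃ a s', a.IsLocal p ∧ Step S (ξ.state u') a s' := by
    filter_upwards [hquery, hreplies] with u' ⟨hseq, req, replies, hphase⟩ hreplies
    have hmajority : IsMajority S {r | replies r ≠ none} :=
      hmaj.mono fun r hr hcorrect => hreplies r hr hcorrect hseq req replies hphase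
    obtain ⟨τ, v, hmax⟩ := exists_isMaxReply hmajority.exists_mem
    exact ⟨_, _, .inl rfl,
      .endQuery _ p req replies τ v (hp.not_crashed u') hphase hmajority hmax⟩
  obtain ⟨u', ⟨a, ha, hstep⟩, ⟨-, req, replies, hphase⟩, -, req', replies', hphase'⟩ :=
    ((hfair.frequently_isLocal hp henabled).and_eventually
      (hquery.and ((tendsto_add_atTop_nat 1).eventually hquery))).exists
  rcases hstep.phase_of_isLocal ha with ⟨-, _, _, _, _, h⟩ | ⟨⟨_, _, _, _, h⟩, -⟩
  · cases hphase'.symm.trans h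
  · cases hphase.symm.trans h

theorem not_eventually_propagation (hfair : ξ.Fair) (hmaj : IsMajority S {r | ξ.Correct r})
    (hp : ξ.Correct p) {pair : Tag P × V}
    (hm : ∀ r ∈ S, ⟨p, r, n, .propagate pair⟩ ∈ ξ.net u) :
    ¬ ∀ᶠ u' in atTop,
      ξ.seq u' p = n ∧ ∃ req τ pair acks, ξ.phase u' p = .propagation req τ pair acks := by
  intro hpropagation
  have hacks := (eventually_all_finset S).2 fun r hr => eventually_imp_distrib_left.2
    fun hcorrect : ξ.Correct r => hfair.eventually_mem_acks hp hcorrect (hm r hr)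
  have henabled : ∀ᶠ u' in atTop, ∃ a s', a.IsLocal p ∧ Step S (ξ.state u') a s' := by
    filter_upwards [hpropagation, hacks] with u' ⟨hseq, req, τ, pair, acks, hphase⟩ hacks
    have hmajority : IsMajority S (acks : Set P) :=
      hmaj.mono fun r hr hcorrect => hacks r hr hcorrect hseq req τ pair acks hphase
    exact ⟨_, _, .inr ⟨_, rfl⟩,
      .respond _ p req τ pair acks (hp.not_crashed u') hphase hmajority⟩
  obtain ⟨u', ⟨a, ha, hstep⟩, ⟨-, _, _, _, _, hphase⟩, -, _, _, _, _, hphase'⟩ :=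
    ((hfair.frequently_isLocal hp henabled).and_eventually
      (hpropagation.and ((tendsto_add_atTop_nat 1).eventually hpropagation))).exists
  rcases hstep.phase_of_isLocal ha with ⟨⟨_, _, h⟩, -⟩ | ⟨-, h⟩
  · cases hphase.symm.trans h
  · cases hphase'.symm.trans h

theorem isComplete (hfair : ξ.Fair) (hmaj : IsMajority S {r | ξ.Correct r}) {t : ℕ}
    {req : Request V (Tag P)} (hinv : Invokes ξ.history t p req) (hp : ξ.Correct p) :
    IsComplete ξ.history t := by
  by_contra hincomplete
  have hquiet : ∀ v, t + 1 ≤ v → ∀ e, ξ.history v = some e → e.proc ≠ p := fun v htv e he hproc =>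
    let ⟨t', _, response, hresponds⟩ := exists_respondsAt_of_event hinv htv he hproc
    hincomplete ⟨t', response, hresponds⟩
  have hstuck : ∀ u ≥ t + 1, ∀ u' ≥ u,
      ξ.seq u' p = ξ.seq u p ∧ (ξ.phase u p).EvolvesTo (ξ.phase u' p) := fun u hu u' hu' =>
    seq_eq_and_evolvesTo_of_no_event hu' fun v huv _ => hquiet v (hu.trans huv)
  obtain ⟨-, -, hphase, hsent⟩ := of_invokes hinv
  obtain ⟨u, hu, hnot_query⟩ : ∃ u ≥ t + 1, ¬ ∃ req replies, ξ.phase u p = .query req replies := by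
    by_contra! hquery
    exact hfair.not_eventually_query hmaj hp hsent
      (eventually_atTop.2 ⟨t + 1, fun u hu => ⟨(hstuck _ le_rfl u hu).1, hquery u hu⟩⟩)
  have hpropagation : ∃ req τ pair acks, ξ.phase u p = .propagation req τ pair acks := by
    have hevolves := (hstuck _ le_rfl u hu).2
    rw [hphase] at hevolves
    generalize ξ.phase u p = ph at hevolves hnot_query
    cases hevolves with
    | query => exact absurd ⟨_, _, rfl⟩ hnot_query
    | endQuery => exact ⟨_, _, _, _, rfl⟩
  obtain ⟨req', τ, pair, acks, hphase_u⟩ := hpropagation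
  obtain ⟨v, -, hseq_v, -, -, -, -, -, -, hsent'⟩ := exists_query_of_propagation hphase_u
  refine hfair.not_eventually_propagation hmaj hp hsent' (eventually_atTop.2 ⟨u, fun u' hu' => ?_⟩)
  obtain ⟨hseq, hevolves⟩ := hstuck u hu u' hu'
  refine ⟨hseq.trans hseq_v.symm, ?_⟩
  rw [hphase_u] at hevolves
  generalize ξ.phase u' p = ph at hevolves
  cases hevolves with
  | propagation => exact ⟨_, _, _, _, rfl⟩

end Fair

end Execution

end Executions

end VMWABD

theorem mainTheorem2 {P V : Type*} [LinearOrder P] (S : Finset P) (τ₀ : VMWABD.Tag P) (v₀ : V) :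
    (∀ ξ : VMWABD.Execution S τ₀ v₀,
      VersionedRegister.IsWeaklyCoverableAtomic τ₀ v₀ ξ.history) ∧
    (∀ ξ : VMWABD.Execution S τ₀ v₀, ξ.Fair → VMWABD.IsMajority S {r | ξ.Correct r} →
      ∀ t p i, VersionedRegister.Invokes ξ.history t p i → ξ.Correct p →
        VersionedRegister.IsComplete ξ.history t) :=
  ⟨fun ξ => ξ.isWeaklyCoverableAtomic,
    fun _ hfair hmaj _ _ _ hinv hp => hfair.isComplete hmaj hinv hp⟩
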